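/- For a real function $w$ on $\mathbb{R}^n$ write $Z(w)=\{x\in\mathbb{R}^n : w(x)=0\}$, and, for $r>0$, let $$N_w(0,r)=\frac{r\int_{B_r}|\nabla w|^2\,dx}{\int_{\partial B_r}w^2\,d\sigma}$$ be its frequency function, where $B_r$ is the open ball of radius $r$ centred at $0$ and $\sigma$ is surface measure (for $w\equiv 0$ we put $N_w(0,r)=0$). Suprema of $v/u$ over $B_r$ are taken in $[-\infty,\infty]$ over the points of $B_r$ where $u\neq 0$. (a) Let $u,v$ be harmonic on $\mathbb{R}^n$, let $u$ be a polynomial, and suppose that $Z(u)=Z(v)$. Then there is a constant $c\in\mathbb{R}\setminus\{0\}$ such that $v=c\,u$. (b) For every $n$ and every $N_0<\infty$ there is $\beta=\beta(n,N_0)\in(0,1)$ such that the following holds for all harmonic functions $u,v$ on $\mathbb{R}^n$ with $N_u(0,r)<N_0$ for all $r>0$. If $Z(u)\subset Z(v)$ and $$\liminf_{r\to\infty}\; r^{-\beta}\,\sup_{B_r}\frac{v}{u}<\infty,\qquad(*)$$ then $v=c\,u$ for some $c\in\mathbb{R}$. Moreover, if $Z(u)=Z(v)$, then $(*)$ is satisfied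 and $v=c\,u$ for some $c\in\mathbb{R}\setminus\{0\}$. -/

import Mathlib

open MeasureTheory

noncomputable section

namespace NodalRatio

/-- The zero set `Z(w)` of a function on `ℝⁿ`. -/
def zeroSet {n : ℕ} (w : EuclideanSpace ℝ (Fin n) → ℝ) : Set (EuclideanSpace ℝ (Fin n)) :=
  {x | w x = 0}

/-- `w` is harmonic on all of `ℝⁿ` (of class `C²` with vanishing Laplacian). -/
def IsEntireHarmonic {n : ℕ} (w : EuclideanSpace ℝ (Fin n) → ℝ) : Prop :=
  InnerProductSpace.HarmonicOnNhd w Set.univ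

/-- `w` is given by a real polynomial in the `n` coordinates. -/
def IsPolynomialFunction {n : ℕ} (w : EuclideanSpace ℝ (Fin n) → ℝ) : Prop :=
  ∃ p : MvPolynomial (Fin n) ℝ, ∀ x, w x = MvPolynomial.eval (fun i => x i) p

/-- The integral of `f` over the sphere `∂B_r(x₀)` with respect to surface measure, through the
parametrization `θ ↦ x₀ + r θ` by the unit sphere; `volume.toSphere` is the (non-normalized)
surface measure of the unit sphere. -/
def sphereIntegral {n : ℕ} (f : EuclideanSpace ℝ (Fin n) → ℝ) (x₀ : EuclideanSpace ℝ (Fin n))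
    (r : ℝ) : ℝ :=
  r ^ (n - 1) *
    ∫ θ : Metric.sphere (0 : EuclideanSpace ℝ (Fin n)) 1,
      f (x₀ + r • (θ : EuclideanSpace ℝ (Fin n)))
        ∂(volume : Measure (EuclideanSpace ℝ (Fin n))).toSphere

/-- The frequency function `N_w(x₀, r) = r ∫_{B_r(x₀)} |∇w|² / ∫_{∂B_r(x₀)} w²`. -/
def frequency {n : ℕ} (w : EuclideanSpace ℝ (Fin n) → ℝ) (x₀ : EuclideanSpace ℝ (Fin n))
    (r : ℝ) : ℝ :=
  r * (∫ x in Metric.ball x₀ r, ‖gradient w x‖ ^ 2) / sphereIntegral (fun x => w x ^ 2) x₀ r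

/-- `sup_{B_r} v / u`, an extended real number; the ratio is taken where `u ≠ 0`. -/
def supRatio {n : ℕ} (u v : EuclideanSpace ℝ (Fin n) → ℝ) (r : ℝ) : EReal :=
  ⨆ x ∈ Metric.ball (0 : EuclideanSpace ℝ (Fin n)) r \ zeroSet u, ((v x / u x : ℝ) : EReal)

/-- The growth condition `liminf_{r → ∞} r^{-β} sup_{B_r} v / u < ∞`. -/
def RatioGrowth {n : ℕ} (β : ℝ) (u v : EuclideanSpace ℝ (Fin n) → ℝ) : Prop :=
  Filter.liminf (fun r : ℝ => ((r ^ (-β) : ℝ) : EReal) * supRatio u v r) Filter.atTop < ⊤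

end NodalRatio

end

noncomputable section

open Set Filter Topology

namespace NodalRatio

/-! Everything rests on one fact: for an entire harmonic `v`, a radial weight `K` supported in the
unit ball and a polynomial `q`, the moment `∫ K(x) v(rx) q(x) dx` is a polynomial in `r` of degree
at most `deg q`, however fast `v` grows (`IsHarm.exists_moment_polynomial`). This is the mean value
property, the coordinates in `q` being removed by integration by parts.

Liouville property. Let `u` be a nonzero harmonic polynomial of degree `d`. The weighted mean of `u
v` over `B_r` is then a polynomial in `r` of degree at most `2d`. If `v/u ≤ C√r` on `B_r`, then
`|uv| ≤ 2C√r u² - uv`, so the one-sided bound becomes an `L¹` bound of order `r^(2d + 1/2)`. Testing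
against the homogeneous parts of the Taylor series of `uv` kills those of degree above `2d`. The
resulting recurrence, together with the super-geometric decay of the Taylor components of `v`, makes
`v` a polynomial of degree at most `d` (`IsHarm.exists_polynomial_of_growth`).

Divisibility. The top form of a harmonic polynomial is orthogonal to all polynomials of lower
degree, so a nonnegative factor of `u` is constant. Hence `u` is squarefree, its nonconstant factors
change sign, and `u` divides every polynomial vanishing on `Z(u)`
(`IsHarm.dvd_of_forall_ev_eq_zero`). Comparing degrees, `v = c u` (`IsHarm.exists_eq_const_mul`).

Equal zero sets. On a generic line `u` has only simple zeros, and there `v` must change sign as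
well, by the strong minimum principle. So `uv` has a constant sign (`IsHarm.mul_nonneg_or_nonpos`);
up to replacing `v` by `-v`, `v/u ≤ 0` and the Liouville property applies with `C = 0`.

Bounded frequency makes the weighted mean squares of `u` grow polynomially, so `u` is a polynomial
(`IsHarm.exists_polynomial_of_frequency`). Thus `β = 1/2` works for all `n` and `N₀`. -/

/-- Euclidean space `ℝⁿ`. -/
abbrev Euc (n : ℕ) := EuclideanSpace ℝ (Fin n)

variable {n : ℕ}

/-- The `i`-th standard basis vector of `ℝⁿ`. -/
abbrev basisVec (i : Fin n) : Euc n := EuclideanSpace.single i (1 : ℝ)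

/-- The derivative of `F` in the direction `e`. -/
def dirDeriv (e : Euc n) (F : Euc n → ℝ) : Euc n → ℝ := fun x => fderiv ℝ F x e

/-- The Laplacian in coordinates. -/
def lap (F : Euc n → ℝ) : Euc n → ℝ :=
  fun x => ∑ i, dirDeriv (basisVec i) (dirDeriv (basisVec i) F) x

/-! ### Radial weights -/

/-- Profiles `k` of the radial weights `x ↦ k (‖x‖ ^ 2)` supported in the closed unit ball. -/
structure IsProfile (k : ℝ → ℝ) : Prop where
  continuous : Continuous k
  eq_zero : ∀ s, 1 ≤ s → k s = 0

/-- The primitive of a profile vanishing at `1`. -/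
def profilePrimitive (k : ℝ → ℝ) (s : ℝ) : ℝ := ∫ t in (1 : ℝ)..s, k t

theorem IsProfile.hasDerivAt_primitive {k : ℝ → ℝ} (hk : IsProfile k) (s : ℝ) :
    HasDerivAt (profilePrimitive k) (k s) s :=
  intervalIntegral.integral_hasDerivAt_right (hk.continuous.intervalIntegrable _ _)
    (hk.continuous.stronglyMeasurableAtFilter _ _) hk.continuous.continuousAt

/-- The base point `1` is where the profile has died out, so the primitive vanishes beyond it too;
the class of profiles is stable under repeated integration by parts. -/
theorem IsProfile.primitive {k : ℝ → ℝ} (hk : IsProfile k) : IsProfile (profilePrimitive k) where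
  continuous := continuous_iff_continuousAt.2 fun s => (hk.hasDerivAt_primitive s).continuousAt
  eq_zero s hs := by
    have : ∀ t ∈ Set.uIcc 1 s, k t = (fun _ => (0 : ℝ)) t := fun t ht => by
      rw [Set.uIcc_of_le hs] at ht
      exact hk.eq_zero t ht.1
    simp [profilePrimitive, intervalIntegral.integral_congr this]

theorem IsProfile.continuous_weight {k : ℝ → ℝ} (hk : IsProfile k) :
    Continuous fun x : Euc n => k (‖x‖ ^ 2) :=
  hk.continuous.comp (continuous_norm.pow 2)

theorem IsProfile.weight_eq_zero {k : ℝ → ℝ} (hk : IsProfile k) {x : Euc n} (hx : 1 ≤ ‖x‖) :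
    k (‖x‖ ^ 2) = 0 :=
  hk.eq_zero _ (one_le_pow₀ hx)

theorem IsProfile.hasCompactSupport_mul {k : ℝ → ℝ} (hk : IsProfile k) (F : Euc n → ℝ) :
    HasCompactSupport fun x : Euc n => k (‖x‖ ^ 2) * F x := by
  refine HasCompactSupport.intro (isCompact_closedBall (0 : Euc n) 1) fun x hx => ?_
  rw [mem_closedBall_zero_iff, not_le] at hx
  simp [hk.weight_eq_zero hx.le]

theorem IsProfile.integrable_mul {k : ℝ → ℝ} (hk : IsProfile k) {F : Euc n → ℝ}
    (hF : Continuous F) : Integrable fun x : Euc n => k (‖x‖ ^ 2) * F x :=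
  (hk.continuous_weight.mul hF).integrable_of_hasCompactSupport (hk.hasCompactSupport_mul F)

theorem IsProfile.hasFDerivAt_primitive {k : ℝ → ℝ} (hk : IsProfile k) (x : Euc n) :
    HasFDerivAt (fun x : Euc n => profilePrimitive k (‖x‖ ^ 2))
      (k (‖x‖ ^ 2) • (2 • (innerSL ℝ) x)) x :=
  (hk.hasDerivAt_primitive _).comp_hasFDerivAt x (hasStrictFDerivAt_norm_sq x).hasFDerivAt

theorem continuous_dirDeriv {F : Euc n → ℝ} (hF : ContDiff ℝ 1 F) (e : Euc n) :
    Continuous (dirDeriv e F) :=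
  (hF.continuous_fderiv one_ne_zero).clm_apply continuous_const

/-- Integration by parts against a radial weight. -/
theorem IsProfile.integral_coord_mul {k : ℝ → ℝ} (hk : IsProfile k) {F : Euc n → ℝ}
    (hF : ContDiff ℝ 1 F) (i : Fin n) :
    ∫ x, k (‖x‖ ^ 2) * (x i * F x) =
      -(1 / 2) * ∫ x, profilePrimitive k (‖x‖ ^ 2) * dirDeriv (basisVec i) F x := by
  -- Up to the factor 2, `k(‖x‖²) x_i` is a derivative of the primitive weight; compact support
  -- leaves no boundary term.
  have hd : ∀ x : Euc n, fderiv ℝ (fun x : Euc n => profilePrimitive k (‖x‖ ^ 2)) x (basisVec i)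
      = 2 * (k (‖x‖ ^ 2) * x i) := fun x => by
    rw [(hk.hasFDerivAt_primitive x).fderiv]
    simp [EuclideanSpace.inner_single_right]
    ring
  have hc : Continuous fun x : Euc n => x i := by fun_prop
  have key := integral_mul_fderiv_eq_neg_fderiv_mul_of_integrable (μ := (volume : Measure (Euc n)))
    (f := fun x : Euc n => profilePrimitive k (‖x‖ ^ 2)) (g := F) (v := basisVec i)
    (by
      simp_rw [hd]
      have := (hk.integrable_mul (hc.mul hF.continuous)).const_mul 2
      refine this.congr (Eventually.of_forall fun x => ?_)
      simp only [Pi.mul_apply]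
      ring)
    (hk.primitive.integrable_mul (continuous_dirDeriv hF _))
    (hk.primitive.integrable_mul hF.continuous)
    (fun x _ => (hk.hasFDerivAt_primitive x).differentiableAt)
    (fun x _ => (hF.differentiable one_ne_zero) x)
  simp_rw [hd] at key
  unfold dirDeriv
  rw [key, ← integral_neg, ← integral_const_mul]
  refine integral_congr_ae (Eventually.of_forall fun x => ?_)
  simp only
  ring

theorem dirDeriv_eq_sum (F : Euc n → ℝ) (e x : Euc n) :
    dirDeriv e F x = ∑ i, e i * dirDeriv (basisVec i) F x := by
  have he : e = ∑ i, e i • basisVec i := by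
    ext j
    simp [Finset.sum_apply, Pi.single_apply]
  unfold dirDeriv
  conv_lhs => rw [he]
  simp

theorem contDiff_dirDeriv {m k : WithTop ℕ∞} {F : Euc n → ℝ} (hF : ContDiff ℝ k F)
    (h : m + 1 ≤ k) (e : Euc n) : ContDiff ℝ m (dirDeriv e F) :=
  (hF.fderiv_right h).clm_apply contDiff_const

theorem dirDeriv_comp_affine {F : Euc n → ℝ} (hF : Differentiable ℝ F) (e y : Euc n) (r : ℝ) :
    dirDeriv e (fun x => F (y + r • x)) = fun x => r * dirDeriv e F (y + r • x) := by
  funext x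
  have h : HasFDerivAt (fun x : Euc n => y + r • x) (r • ContinuousLinearMap.id ℝ (Euc n)) x :=
    ((hasFDerivAt_id x).const_smul r).const_add y
  have := ((hF (y + r • x)).hasFDerivAt.comp x h).fderiv
  simp only [dirDeriv]
  change fderiv ℝ (F ∘ fun x : Euc n => y + r • x) x e = _
  rw [this]
  simp

/-- The derivative of weighted averages under dilation. -/
theorem IsProfile.hasDerivAt_dilation {k : ℝ → ℝ} (hk : IsProfile k) {F : Euc n → ℝ}
    (hF : ContDiff ℝ 2 F) (y : Euc n) (r : ℝ) :
    HasDerivAt (fun r : ℝ => ∫ x, k (‖x‖ ^ 2) * F (y + r • x))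
      (-(1 / 2) * r * ∫ x, profilePrimitive k (‖x‖ ^ 2) * lap F (y + r • x)) r := by
  have hF1 : ContDiff ℝ 1 F := hF.of_le one_le_two
  have hF' : Differentiable ℝ F := hF.differentiable two_ne_zero
  have hcont : Continuous fun p : ℝ × Euc n => fderiv ℝ F (y + p.1 • p.2) p.2 :=
    ((hF1.continuous_fderiv one_ne_zero).comp (by fun_prop)).clm_apply continuous_snd
  have hcontr : ∀ r : ℝ, Continuous fun x : Euc n => fderiv ℝ F (y + r • x) x := fun r =>
    hcont.comp (by fun_prop : Continuous fun x : Euc n => (r, x))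
  -- The weight vanishes off the unit ball, so a bound on this compact set dominates the derivative
  -- of the integrand.
  obtain ⟨B, hB⟩ := ((isCompact_closedBall r 1).prod (isCompact_closedBall (0 : Euc n) 1)
    ).exists_bound_of_continuousOn
    (f := fun p : ℝ × Euc n => fderiv ℝ F (y + p.1 • p.2) p.2) hcont.continuousOn
  have key := (hasDerivAt_integral_of_dominated_loc_of_deriv_le
    (μ := (volume : Measure (Euc n)))
    (F := fun (r : ℝ) (x : Euc n) => k (‖x‖ ^ 2) * F (y + r • x))
    (F' := fun (r : ℝ) (x : Euc n) => k (‖x‖ ^ 2) * fderiv ℝ F (y + r • x) x)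
    (bound := fun x => |k (‖x‖ ^ 2)| * B) (x₀ := r) (s := Metric.ball r 1)
    (Metric.ball_mem_nhds r one_pos)
    (Eventually.of_forall fun s => (hk.integrable_mul
      (by fun_prop : Continuous fun x : Euc n => F (y + s • x))).aestronglyMeasurable)
    (hk.integrable_mul (by fun_prop))
    (hk.integrable_mul (hcontr r)).aestronglyMeasurable
    (Eventually.of_forall fun x s hs => ?_) ?_
    (Eventually.of_forall fun x s hs => ?_)).2
  · refine key.congr_deriv ?_
    -- The radial derivative is `∑ x_i ∂_i F`; removing each `x_i` by parts produces a second
    -- derivative, and the chain rule the factor `r`.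
    have h1 : ∀ x : Euc n, k (‖x‖ ^ 2) * fderiv ℝ F (y + r • x) x =
        ∑ i, k (‖x‖ ^ 2) * (x i * dirDeriv (basisVec i) F (y + r • x)) := fun x => by
      rw [← Finset.mul_sum, ← dirDeriv_eq_sum]
      rfl
    have h2 : ∀ i : Fin n, ContDiff ℝ 1 fun x : Euc n => dirDeriv (basisVec i) F (y + r • x) :=
      fun i => (contDiff_dirDeriv hF (by norm_num [one_add_one_eq_two]) _).comp (by fun_prop)
    have h3 : ∀ i : Fin n, Continuous fun x : Euc n =>
        dirDeriv (basisVec i) (dirDeriv (basisVec i) F) (y + r • x) := fun i =>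
      (continuous_dirDeriv (contDiff_dirDeriv hF (by norm_num [one_add_one_eq_two]) _) _).comp
        (by fun_prop)
    rw [integral_congr_ae (Eventually.of_forall h1), integral_finsetSum _ fun i _ =>
      hk.integrable_mul (F := fun x => x i * dirDeriv (basisVec i) F (y + r • x))
        ((by fun_prop : Continuous fun x : Euc n => x i).mul (h2 i).continuous)]
    simp_rw [hk.integral_coord_mul (h2 _), dirDeriv_comp_affine
      ((contDiff_dirDeriv hF (by norm_num [one_add_one_eq_two]) _).differentiable one_ne_zero)]
    rw [← Finset.mul_sum, ← integral_finsetSum _ fun i _ => hk.primitive.integrable_mul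
      (F := fun x => r * dirDeriv (basisVec i) (dirDeriv (basisVec i) F) (y + r • x))
      (continuous_const.mul (h3 i)), mul_assoc, ← integral_const_mul r]
    congr 2
    funext x
    simp only [lap, Finset.mul_sum]
    refine Finset.sum_congr rfl fun i _ => by ring
  · rw [norm_mul, Real.norm_eq_abs]
    by_cases hx : ‖x‖ ≤ 1
    · exact mul_le_mul_of_nonneg_left
        (hB (s, x) ⟨Metric.ball_subset_closedBall hs, by simpa using hx⟩) (abs_nonneg _)
    · simp [hk.weight_eq_zero (not_le.1 hx).le]
  · refine (hk.integrable_mul (F := fun _ => 1) continuous_const).abs.mul_const B |>.congr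
      (Eventually.of_forall fun x => ?_)
    simp
  · have h : HasDerivAt (fun s : ℝ => y + s • x) x s := by
      simpa using ((hasDerivAt_id s).smul_const x).const_add y
    exact ((hF' (y + s • x)).hasFDerivAt.comp_hasDerivAt s h).const_mul _

/-! ### Harmonic functions: mean values, smoothness, gradient estimates -/

/-- Functions of class `C²` on `ℝⁿ` with vanishing coordinate Laplacian. -/
structure IsHarm (v : Euc n → ℝ) : Prop where
  contDiff : ContDiff ℝ 2 v
  lap_eq_zero : ∀ x, lap v x = 0

theorem dirDeriv_dirDeriv {F : Euc n → ℝ} (hF : ContDiff ℝ 2 F) (a b x : Euc n) :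
    dirDeriv a (dirDeriv b F) x = fderiv ℝ (fderiv ℝ F) x a b := by
  have hd : DifferentiableAt ℝ (fderiv ℝ F) x :=
    (hF.fderiv_right (m := 1) (by norm_num [one_add_one_eq_two])).differentiable one_ne_zero x
  unfold dirDeriv
  rw [fderiv_clm_apply hd (differentiableAt_const b)]
  simp

theorem dirDeriv_comm {F : Euc n → ℝ} (hF : ContDiff ℝ 2 F) (a b : Euc n) :
    dirDeriv a (dirDeriv b F) = dirDeriv b (dirDeriv a F) := by
  funext x
  rw [dirDeriv_dirDeriv hF, dirDeriv_dirDeriv hF]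
  exact (hF.contDiffAt.isSymmSndFDerivAt (by simp)) a b

theorem IsEntireHarmonic.isHarm {v : Euc n → ℝ} (hv : IsEntireHarmonic v) : IsHarm v := by
  have hc : ContDiff ℝ 2 v := contDiff_iff_contDiffAt.2 fun x => (hv x (mem_univ x)).1
  refine ⟨hc, fun x => ?_⟩
  have h := (hv x (mem_univ x)).2.self_of_nhds
  rw [InnerProductSpace.laplacian_eq_iteratedFDeriv_orthonormalBasis v
    (EuclideanSpace.basisFun (Fin n) ℝ)] at h
  simp only [Pi.zero_apply] at h
  rw [← h]
  refine Finset.sum_congr rfl fun i _ => ?_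
  rw [dirDeriv_dirDeriv hc, iteratedFDeriv_two_apply]
  simp

/-- Mean value property: by `IsProfile.hasDerivAt_dilation` the left side has zero derivative in
`r`, and at `r = 0` it is the right side. -/
theorem IsHarm.integral_weight {v : Euc n → ℝ} (hv : IsHarm v) {k : ℝ → ℝ} (hk : IsProfile k)
    (y : Euc n) (r : ℝ) :
    ∫ x, k (‖x‖ ^ 2) * v (y + r • x) = v y * ∫ x : Euc n, k (‖x‖ ^ 2) := by
  have hd := fun r => hk.hasDerivAt_dilation hv.contDiff y r
  have h := is_const_of_deriv_eq_zero (fun r => (hd r).differentiableAt)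
    (fun r => by rw [(hd r).deriv]; simp [hv.lap_eq_zero]) r 0
  rw [h]
  simp only [zero_smul, add_zero, integral_mul_const]
  ring

/-- A smooth profile, positive on `(-∞, 1)`. -/
def bump (s : ℝ) : ℝ := Real.smoothTransition (1 - s)

theorem isProfile_bump : IsProfile bump where
  continuous := Real.smoothTransition.continuous.comp (by fun_prop)
  eq_zero s hs := Real.smoothTransition.zero_of_nonpos (by linarith)

theorem bump_nonneg (s : ℝ) : 0 ≤ bump s := Real.smoothTransition.nonneg _

theorem bump_pos {s : ℝ} (hs : s < 1) : 0 < bump s :=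
  Real.smoothTransition.pos_of_pos (by linarith)

theorem contDiff_bump_weight : ContDiff ℝ (⊤ : ℕ∞) fun x : Euc n => bump (‖x‖ ^ 2) :=
  Real.smoothTransition.contDiff.comp (contDiff_const.sub (contDiff_norm_sq ℝ))

theorem hasCompactSupport_bump_weight : HasCompactSupport fun x : Euc n => bump (‖x‖ ^ 2) := by
  simpa using isProfile_bump.hasCompactSupport_mul (n := n) fun _ => 1

theorem continuous_bump_weight : Continuous fun x : Euc n => bump (‖x‖ ^ 2) :=
  isProfile_bump.continuous_weight

theorem integrable_bump_mul {F : Euc n → ℝ} (hF : Continuous F) :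
    Integrable fun x : Euc n => bump (‖x‖ ^ 2) * F x :=
  isProfile_bump.integrable_mul hF

theorem integral_bump_pos : 0 < ∫ x : Euc n, bump (‖x‖ ^ 2) :=
  continuous_bump_weight.integral_pos_of_hasCompactSupport_nonneg_nonzero
    hasCompactSupport_bump_weight (fun _ => bump_nonneg _) (x := 0)
    (by simpa using (bump_pos zero_lt_one).ne')

/-- The mean value property at scale 1 exhibits `v` as a multiple of its own convolution with a
smooth bump. -/
theorem IsHarm.contDiff_top {v : Euc n → ℝ} (hv : IsHarm v) : ContDiff ℝ (⊤ : ℕ∞) v := by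
  have h : v = fun y => (∫ x : Euc n, bump (‖x‖ ^ 2))⁻¹ *
      (convolution v (fun x : Euc n => bump (‖x‖ ^ 2))
        (ContinuousLinearMap.lsmul ℝ ℝ) volume y) := by
    funext y
    rw [eq_inv_mul_iff_mul_eq₀ integral_bump_pos.ne', mul_comm,
      ← hv.integral_weight isProfile_bump y 1, convolution_def,
      ← integral_add_left_eq_self (fun t => (ContinuousLinearMap.lsmul ℝ ℝ) (v t)
        (bump (‖y - t‖ ^ 2))) y]
    refine integral_congr_ae (Eventually.of_forall fun x => ?_)
    simp [mul_comm]
  rw [h]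
  exact contDiff_const.mul (hasCompactSupport_bump_weight.contDiff_convolution_right _
    hv.contDiff.continuous.locallyIntegrable contDiff_bump_weight)

theorem IsHarm.isHarm_dirDeriv {v : Euc n → ℝ} (hv : IsHarm v) (e : Euc n) :
    IsHarm (dirDeriv e v) := by
  have h3 : ContDiff ℝ 3 v := hv.contDiff_top.of_le (WithTop.coe_le_coe.2 le_top)
  have hD : ∀ a, ContDiff ℝ 2 (dirDeriv a v) := fun a =>
    contDiff_dirDeriv h3 (by norm_num) a
  refine ⟨hD e, fun x => ?_⟩
  have h1 : ∀ i : Fin n, dirDeriv (basisVec i) (dirDeriv (basisVec i)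
      (dirDeriv e v)) =
      dirDeriv e (dirDeriv (basisVec i)
        (dirDeriv (basisVec i) v)) := fun i => by
    rw [dirDeriv_comm hv.contDiff (basisVec i) e, dirDeriv_comm (hD _)]
  have h2 : dirDeriv e (lap v) x = 0 := by
    have : lap v = fun _ => 0 := funext hv.lap_eq_zero
    simp [dirDeriv, this]
  rw [← h2]
  simp only [lap, h1]
  have h4 : ∀ i : Fin n, DifferentiableAt ℝ (dirDeriv (basisVec i)
      (dirDeriv (basisVec i) v)) x := fun i =>
    (contDiff_dirDeriv (m := 1) (hD _) (by norm_num [one_add_one_eq_two]) _).differentiable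
      one_ne_zero x
  change _ = fderiv ℝ (fun x => ∑ i, dirDeriv (basisVec i)
    (dirDeriv (basisVec i) v) x) x e
  rw [fderiv_fun_sum fun i _ => h4 i]
  simp [dirDeriv]

/-- The constant in the gradient estimate. -/
def gradConst (n : ℕ) : ℝ :=
  (∫ x : Euc n, bump (‖x‖ ^ 2))⁻¹ * ∫ x : Euc n, ‖fderiv ℝ (fun x : Euc n => bump (‖x‖ ^ 2)) x‖

theorem gradConst_nonneg (n : ℕ) : 0 ≤ gradConst n :=
  mul_nonneg (inv_nonneg.2 integral_bump_pos.le) (integral_nonneg fun _ => norm_nonneg _)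

/-- The derivative is harmonic, hence a weighted mean over a ball of radius `r`; moving it onto the
bump gains the factor `1/r`. -/
theorem IsHarm.abs_dirDeriv_le {v : Euc n → ℝ} (hv : IsHarm v) (e y : Euc n) {r M : ℝ}
    (hr : 0 < r) (hM : ∀ x, ‖x‖ ≤ 1 → |v (y + r • x)| ≤ M) :
    |dirDeriv e v y| ≤ gradConst n * ‖e‖ / r * M := by
  set K : Euc n → ℝ := fun x => bump (‖x‖ ^ 2) with hK
  have hI := integral_bump_pos (n := n)
  have hv1 : ContDiff ℝ 1 v := hv.contDiff.of_le one_le_two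
  have hKd : ContDiff ℝ 1 K := contDiff_bump_weight.of_le (by exact_mod_cast le_top)
  have hvy : ContDiff ℝ 1 fun x => v (y + r • x) := hv1.comp (by fun_prop)
  have hKs : HasCompactSupport (fderiv ℝ K) := hasCompactSupport_bump_weight.fderiv ℝ
  have hKc : Continuous (fderiv ℝ K) := hKd.continuous_fderiv one_ne_zero
  have hKz : ∀ x, 1 < ‖x‖ → fderiv ℝ K x = 0 := fun x hx => by
    have : K =ᶠ[𝓝 x] fun _ => 0 := by
      filter_upwards [continuous_norm.continuousAt.eventually (lt_mem_nhds hx)] with z hz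
      exact isProfile_bump.weight_eq_zero hz.le
    rw [this.fderiv_eq]
    simp
  have hint : Integrable fun x => fderiv ℝ K x e * v (y + r • x) := by
    refine ((hKc.clm_apply continuous_const).mul hvy.continuous).integrable_of_hasCompactSupport ?_
    refine HasCompactSupport.intro (isCompact_closedBall (0 : Euc n) 1) fun x hx => ?_
    rw [mem_closedBall_zero_iff, not_le] at hx
    simp [hKz x hx]
  have key := integral_mul_fderiv_eq_neg_fderiv_mul_of_integrable
    (μ := (volume : Measure (Euc n))) (f := K) (g := fun x => v (y + r • x)) (v := e) hint
    (integrable_bump_mul (continuous_dirDeriv hvy e)) (integrable_bump_mul hvy.continuous)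
    (fun x _ => hKd.differentiable one_ne_zero x) (fun x _ => hvy.differentiable one_ne_zero x)
  have h1 : ∫ x, K x * fderiv ℝ (fun x => v (y + r • x)) x e =
      r * (dirDeriv e v y * ∫ x, K x) := by
    rw [← (hv.isHarm_dirDeriv e).integral_weight isProfile_bump y r, ← integral_const_mul]
    refine integral_congr_ae (Eventually.of_forall fun x => ?_)
    have := congrFun (dirDeriv_comp_affine (hv1.differentiable one_ne_zero) e y r) x
    simp only [dirDeriv] at this ⊢
    rw [this]
    ring
  have h2 : |∫ x, fderiv ℝ K x e * v (y + r • x)| ≤ ∫ x, ‖fderiv ℝ K x‖ * (‖e‖ * M) := by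
    refine (abs_integral_le_integral_abs).trans (integral_mono hint.abs
      ((hKc.integrable_of_hasCompactSupport hKs).norm.mul_const _) fun x => ?_)
    simp only
    by_cases hx : ‖x‖ ≤ 1
    · rw [abs_mul, ← mul_assoc]
      exact mul_le_mul ((fderiv ℝ K x).le_opNorm e) (hM x hx) (abs_nonneg _) (by positivity)
    · simp [hKz x (not_le.1 hx)]
  rw [h1] at key
  rw [integral_mul_const] at h2
  rw [← abs_neg, ← key, abs_mul, abs_mul, abs_of_pos hr, abs_of_pos hI] at h2
  have h3 : gradConst n * ‖e‖ / r * M =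
      ((∫ x, ‖fderiv ℝ K x‖) * (‖e‖ * M)) / (r * ∫ x, K x) := by
    change (∫ x, K x)⁻¹ * (∫ x, ‖fderiv ℝ K x‖) * ‖e‖ / r * M = _
    have hI' : (∫ x, K x) ≠ 0 := hI.ne'
    field_simp
  rw [h3, le_div_iff₀ (mul_pos hr hI)]
  linarith

theorem IsHarm.neg {v : Euc n → ℝ} (hv : IsHarm v) : IsHarm fun x => -v x := by
  have h : ∀ (F : Euc n → ℝ) (e : Euc n), dirDeriv e (fun x => -F x) =
      fun x => -dirDeriv e F x := fun F e => by
    funext x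
    simp [dirDeriv, fderiv_fun_neg]
  refine ⟨hv.contDiff.neg, fun x => ?_⟩
  simp only [lap, h, Finset.sum_neg_distrib]
  exact neg_eq_zero.2 (hv.lap_eq_zero x)

/-! ### Positivity of the weight and the strong minimum principle. -/

theorem eq_zero_of_integral_bump_mul_eq_zero {F : Euc n → ℝ} (hF : Continuous F)
    (hnn : ∀ x, ‖x‖ < 1 → 0 ≤ F x) (h0 : ∫ x, bump (‖x‖ ^ 2) * F x = 0) {x : Euc n}
    (hx : ‖x‖ < 1) : F x = 0 := by
  by_contra hne
  have hb := bump_pos (pow_lt_one₀ (norm_nonneg x) hx two_ne_zero)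
  refine ((continuous_bump_weight.mul hF).integral_pos_of_hasCompactSupport_nonneg_nonzero
    (isProfile_bump.hasCompactSupport_mul F) (fun y => ?_)
    (x := x) (mul_ne_zero hb.ne' hne)).ne' h0
  by_cases hy : ‖y‖ < 1
  · exact mul_nonneg (bump_nonneg _) (hnn y hy)
  · simp [isProfile_bump.weight_eq_zero (not_lt.1 hy)]

/-- The local strong minimum principle. -/
theorem IsHarm.eq_of_forall_le {v : Euc n → ℝ} (hv : IsHarm v) {y : Euc n} {r : ℝ} (hr : 0 < r)
    (h : ∀ x ∈ Metric.ball y r, v y ≤ v x) : ∀ x ∈ Metric.ball y r, v x = v y := by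
  have hvc : Continuous fun x => v (y + r • x) := hv.contDiff.continuous.comp (by fun_prop)
  -- By the mean value property the nonnegative function `v - v y` has zero weighted integral.
  have h0 : ∫ x, bump (‖x‖ ^ 2) * (v (y + r • x) - v y) = 0 := by
    simp_rw [mul_sub]
    rw [integral_sub (integrable_bump_mul hvc)
      (integrable_bump_mul continuous_const), hv.integral_weight isProfile_bump, integral_mul_const]
    ring
  have hball : ∀ x : Euc n, ‖x‖ < 1 → y + r • x ∈ Metric.ball y r := fun x hx => by
    rw [mem_ball_iff_norm, add_sub_cancel_left, norm_smul, Real.norm_of_nonneg hr.le]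
    nlinarith
  intro x hx
  have hx' : ‖r⁻¹ • (x - y)‖ < 1 := by
    rw [norm_smul, norm_inv, Real.norm_of_nonneg hr.le, inv_mul_lt_iff₀ hr, mul_one]
    exact mem_ball_iff_norm.1 hx
  have : v (y + r • r⁻¹ • (x - y)) - v y = 0 := eq_zero_of_integral_bump_mul_eq_zero
    (hvc.sub continuous_const) (fun x hx => sub_nonneg.2 (h _ (hball x hx))) h0 hx'
  simp only [smul_smul, mul_inv_cancel₀ hr.ne', one_smul, add_sub_cancel] at this
  linarith

/-! ### Polynomial functions -/

/-- Evaluation of a real polynomial at a point of `ℝⁿ`. -/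
def ev (p : MvPolynomial (Fin n) ℝ) (x : Euc n) : ℝ := MvPolynomial.eval (fun i => x i) p

@[simp] theorem ev_C (c : ℝ) (x : Euc n) : ev (MvPolynomial.C c) x = c := by simp [ev]

@[simp] theorem ev_X (i : Fin n) (x : Euc n) : ev (MvPolynomial.X i) x = x i := by simp [ev]

@[simp] theorem ev_zero (x : Euc n) : ev 0 x = 0 := by simp [ev]

@[simp] theorem ev_one (x : Euc n) : ev 1 x = 1 := by simp [ev]

@[simp] theorem ev_add (p q : MvPolynomial (Fin n) ℝ) (x : Euc n) :
    ev (p + q) x = ev p x + ev q x := by simp [ev]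

@[simp] theorem ev_neg (p : MvPolynomial (Fin n) ℝ) (x : Euc n) : ev (-p) x = -ev p x := by
  simp [ev]

@[simp] theorem ev_mul (p q : MvPolynomial (Fin n) ℝ) (x : Euc n) :
    ev (p * q) x = ev p x * ev q x := by simp [ev]

theorem ev_sum {ι : Type*} (s : Finset ι) (p : ι → MvPolynomial (Fin n) ℝ) (x : Euc n) :
    ev (∑ i ∈ s, p i) x = ∑ i ∈ s, ev (p i) x := by simp [ev]

theorem ev_smul_of_isHomogeneous {p : MvPolynomial (Fin n) ℝ} {d : ℕ} (hp : p.IsHomogeneous d)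
    (r : ℝ) (x : Euc n) : ev p (r • x) = r ^ d * ev p x := by
  unfold ev
  rw [MvPolynomial.eval_eq', MvPolynomial.eval_eq', Finset.mul_sum]
  refine Finset.sum_congr rfl fun s hs => ?_
  have hd : ∑ i, s i = d := by
    have := hp (MvPolynomial.mem_support_iff.1 hs)
    rw [← this, Finsupp.weight_apply, Finsupp.sum_fintype _ _ (by simp)]
    simp
  rw [← hd, ← Finset.prod_pow_eq_pow_sum]
  simp only [PiLp.smul_apply, smul_eq_mul, mul_pow, Finset.prod_mul_distrib]
  ring

theorem ext_of_ev {p q : MvPolynomial (Fin n) ℝ} (h : ∀ x, ev p x = ev q x) : p = q :=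
  MvPolynomial.funext fun x => h (WithLp.toLp 2 x)

theorem contDiff_ev {m : WithTop ℕ∞} (p : MvPolynomial (Fin n) ℝ) : ContDiff ℝ m (ev p) := by
  induction p using MvPolynomial.induction_on with
  | C a => simpa [funext (ev_C a)] using contDiff_const
  | add p q hp hq =>
    rw [show ev (p + q) = fun x => ev p x + ev q x from funext (ev_add p q)]
    exact hp.add hq
  | mul_X p i hp =>
    rw [show ev (p * MvPolynomial.X i) = fun x => ev p x * x i from funext fun x => by simp]
    exact hp.mul (by fun_prop)

theorem continuous_ev (p : MvPolynomial (Fin n) ℝ) : Continuous (ev p) :=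
  (contDiff_ev (m := 0) p).continuous

theorem differentiable_ev (p : MvPolynomial (Fin n) ℝ) : Differentiable ℝ (ev p) :=
  (contDiff_ev (m := 1) p).differentiable one_ne_zero

theorem dirDeriv_mul {F G : Euc n → ℝ} (hF : Differentiable ℝ F) (hG : Differentiable ℝ G)
    (e x : Euc n) :
    dirDeriv e (fun x => F x * G x) x = dirDeriv e F x * G x + F x * dirDeriv e G x := by
  simp only [dirDeriv]
  rw [fderiv_fun_mul (hF x) (hG x)]
  simp
  ring

theorem dirDeriv_ev (i : Fin n) (p : MvPolynomial (Fin n) ℝ) :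
    dirDeriv (basisVec i) (ev p) = ev (MvPolynomial.pderiv i p) := by
  funext x
  induction p using MvPolynomial.induction_on with
  | C a => simp [funext (ev_C a), dirDeriv]
  | add p q hp hq =>
    rw [show ev (p + q) = fun x => ev p x + ev q x from funext (ev_add p q), map_add, ev_add,
      ← hp, ← hq]
    simp only [dirDeriv]
    rw [fderiv_fun_add (differentiable_ev p x) (differentiable_ev q x)]
    rfl
  | mul_X p j hp =>
    have hX : dirDeriv (basisVec i) (fun x : Euc n => x j) x = if i = j then 1 else 0 := by
      have : HasFDerivAt (fun x : Euc n => x j) (EuclideanSpace.proj j : Euc n →L[ℝ] ℝ) x :=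
        (EuclideanSpace.proj j : Euc n →L[ℝ] ℝ).hasFDerivAt
      simp [dirDeriv, this.fderiv, eq_comm]
    rw [show ev (p * MvPolynomial.X j) = fun x => ev p x * x j from funext fun x => by simp,
      dirDeriv_mul (differentiable_ev p) (by fun_prop), hp, hX]
    simp only [Derivation.leibniz, MvPolynomial.pderiv_X, smul_eq_mul, ev_add, ev_mul, ev_X]
    by_cases h : i = j
    · subst h
      simp
      ring
    · simp [h, Ne.symm h]
      ring

/-! ### Weighted moments of harmonic functions -/

/-- The weighted moments of the dilates of a harmonic function against a polynomial of degree at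
most `d` are polynomials of degree at most `d` in the dilation parameter. -/
theorem IsHarm.exists_moment_polynomial (d : ℕ) : ∀ (q : MvPolynomial (Fin n) ℝ),
    q.totalDegree ≤ d → ∀ (k : ℝ → ℝ), IsProfile k → ∀ (v : Euc n → ℝ), IsHarm v →
    ∃ p : Polynomial ℝ, p.natDegree ≤ d ∧
      ∀ r : ℝ, ∫ x, k (‖x‖ ^ 2) * (v (r • x) * ev q x) = p.eval r := by
  induction d using Nat.strong_induction_on with
  | _ d ih =>
  -- Split a coordinate off the monomial and integrate by parts. The derivative falls on `v(rx)`,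
  -- giving `r` times a moment of `∂_i v`, or on the remaining monomial; both moments have degree at
  -- most `d - 1`. The profile becomes its primitive and `v` may become `∂_i v`, hence the
  -- quantification over both in the induction.
  have hmon : ∀ (s : Fin n →₀ ℕ) (a : ℝ), s.degree ≤ d → ∀ (k : ℝ → ℝ), IsProfile k →
      ∀ (v : Euc n → ℝ), IsHarm v → ∃ p : Polynomial ℝ, p.natDegree ≤ d ∧
      ∀ r : ℝ, ∫ x, k (‖x‖ ^ 2) * (v (r • x) * ev (MvPolynomial.monomial s a) x) = p.eval r := by
    intro s a hs k hk v hv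
    by_cases h0 : s = 0
    · refine ⟨Polynomial.C (a * (v 0 * ∫ x : Euc n, k (‖x‖ ^ 2))),
        (Polynomial.natDegree_C _).trans_le (Nat.zero_le _), fun r => ?_⟩
      rw [Polynomial.eval_C, ← hv.integral_weight hk 0 r, ← integral_const_mul]
      refine integral_congr_ae (Eventually.of_forall fun x => ?_)
      simp only [h0, ev, MvPolynomial.eval_monomial, Finsupp.prod_zero_index, zero_add]
      ring
    obtain ⟨i, hi⟩ : ∃ i, s i ≠ 0 := by
      by_contra! h
      exact h0 (Finsupp.ext h)
    set s' := s - Finsupp.single i 1 with hs'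
    have hss : s = s' + Finsupp.single i 1 := by
      ext j
      by_cases hj : j = i
      · subst hj
        simp [hs']
        omega
      · simp [hs', Ne.symm hj]
    have hdeg : s.degree = s'.degree + 1 := by
      conv_lhs => rw [hss]
      simp [Finsupp.degree_single]
    have hd : d - 1 < d := by omega
    set q' := MvPolynomial.monomial s' a with hq'
    have hq : MvPolynomial.monomial s a = MvPolynomial.X i * q' := by
      rw [hq', mul_comm, MvPolynomial.X, MvPolynomial.monomial_mul, ← hss, mul_one]
    have hq'd : q'.totalDegree ≤ d - 1 := by
      refine (MvPolynomial.totalDegree_monomial_le _ _).trans ?_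
      change s'.degree ≤ _
      omega
    have hpd : (MvPolynomial.pderiv i q').totalDegree ≤ d - 1 := by
      rw [hq', MvPolynomial.pderiv_monomial]
      refine (MvPolynomial.totalDegree_monomial_le _ _).trans ?_
      have : (s' - Finsupp.single i 1).degree ≤ s'.degree :=
        Finsupp.degree_mono tsub_le_self
      change (s' - Finsupp.single i 1).degree ≤ _
      omega
    obtain ⟨p₁, hp₁, h₁⟩ := ih (d - 1) hd q' hq'd _ hk.primitive _ (hv.isHarm_dirDeriv (basisVec i))
    obtain ⟨p₂, hp₂, h₂⟩ := ih (d - 1) hd _ hpd _ hk.primitive _ hv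
    refine ⟨Polynomial.C (-(1 / 2)) * (Polynomial.X * p₁ + p₂), ?_, fun r => ?_⟩
    · refine (Polynomial.natDegree_C_mul_le _ _).trans (Polynomial.natDegree_add_le_of_degree_le ?_
        (by omega))
      refine Polynomial.natDegree_mul_le.trans ?_
      have := Polynomial.natDegree_X_le (R := ℝ)
      omega
    · have hvd : Differentiable ℝ v := hv.contDiff.differentiable two_ne_zero
      have hvr : ContDiff ℝ 2 fun x => v (r • x) := hv.contDiff.comp (by fun_prop)
      have hF : ContDiff ℝ 1 fun x => v (r • x) * ev q' x :=
        (hvr.of_le one_le_two).mul (contDiff_ev q')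
      have h3 := hk.integral_coord_mul hF i
      have h4 : ∀ x, dirDeriv (basisVec i) (fun x => v (r • x) * ev q' x) x =
          r * (dirDeriv (basisVec i) v (r • x) * ev q' x) +
            v (r • x) * ev (MvPolynomial.pderiv i q') x := fun x => by
        rw [dirDeriv_mul (hvr.differentiable two_ne_zero) (differentiable_ev q'), dirDeriv_ev]
        have := congrFun (dirDeriv_comp_affine hvd (basisVec i) 0 r) x
        simp only [zero_add] at this
        rw [this]
        ring
      have hc1 : Continuous fun x => dirDeriv (basisVec i) v (r • x) * ev q' x :=
        ((hv.isHarm_dirDeriv _).contDiff.continuous.comp (by fun_prop)).mul (continuous_ev _)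
      have hc2 : Continuous fun x => v (r • x) * ev (MvPolynomial.pderiv i q') x :=
        hvr.continuous.mul (continuous_ev _)
      simp only [h4, mul_add, mul_left_comm _ r] at h3
      rw [integral_add ((hk.primitive.integrable_mul hc1).const_mul r)
        (hk.primitive.integrable_mul hc2), integral_const_mul, h₁, h₂] at h3
      simp only [Polynomial.eval_mul, Polynomial.eval_add, Polynomial.eval_C, Polynomial.eval_X]
      rw [← h3]
      refine integral_congr_ae (Eventually.of_forall fun x => ?_)
      simp only [hq, ev_mul, ev_X]
      ring
  intro q hq k hk v hv
  have : ∀ s : Fin n →₀ ℕ, ∃ p : Polynomial ℝ, s ∈ q.support → p.natDegree ≤ d ∧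
      ∀ r : ℝ, ∫ x, k (‖x‖ ^ 2) *
        (v (r • x) * ev (MvPolynomial.monomial s (q.coeff s)) x) = p.eval r := fun s => by
    by_cases hs : s ∈ q.support
    · obtain ⟨p, hp⟩ := hmon s (q.coeff s) ((MvPolynomial.le_totalDegree hs).trans hq) k hk v hv
      exact ⟨p, fun _ => hp⟩
    · exact ⟨0, fun h => absurd h hs⟩
  choose P hP using this
  refine ⟨∑ s ∈ q.support, P s, Polynomial.natDegree_sum_le_of_forall_le _ _
    fun s hs => (hP s hs).1, fun r => ?_⟩
  have hc : ∀ s, Continuous fun x : Euc n =>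
      v (r • x) * ev (MvPolynomial.monomial s (q.coeff s)) x := fun s =>
    (hv.contDiff.continuous.comp (by fun_prop)).mul (continuous_ev _)
  rw [Polynomial.eval_finsetSum, ← Finset.sum_congr rfl fun s hs => (hP s hs).2 r,
    ← integral_finsetSum _ fun s _ => hk.integrable_mul (hc s)]
  refine integral_congr_ae (Eventually.of_forall fun x => ?_)
  simp only
  rw [← Finset.mul_sum, ← Finset.mul_sum, ← ev_sum, ← MvPolynomial.as_sum]

/-! ### Taylor expansion of entire harmonic functions -/

theorem IsHarm.iterate_dirDeriv {v : Euc n → ℝ} (hv : IsHarm v) (e : Euc n) (k : ℕ) :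
    IsHarm ((dirDeriv e)^[k] v) := by
  induction k with
  | zero => exact hv
  | succ k ih =>
    rw [Function.iterate_succ_apply']
    exact ih.isHarm_dirDeriv e

/-- Each of the `k` applications of the gradient estimate uses up a radius `r`, hence the ball of
radius `k * r`. -/
theorem IsHarm.abs_iterate_dirDeriv_le {v : Euc n → ℝ} (hv : IsHarm v) (e : Euc n) {r M : ℝ}
    (hr : 0 < r) (k : ℕ) : ∀ y : Euc n, (∀ x, ‖x - y‖ ≤ k * r → |v x| ≤ M) →
    |(dirDeriv e)^[k] v y| ≤ (gradConst n * ‖e‖ / r) ^ k * M := by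
  induction k with
  | zero => intro y h; simpa using h y (by simp)
  | succ k ih =>
    intro y h
    rw [Function.iterate_succ_apply', pow_succ', mul_assoc]
    refine (hv.iterate_dirDeriv e k).abs_dirDeriv_le e y hr fun x hx => ih _ fun z hz => h z ?_
    have h1 : z - y = (z - (y + r • x)) + r • x := by abel
    rw [h1]
    refine (norm_add_le _ _).trans ?_
    rw [norm_smul, Real.norm_of_nonneg hr.le]
    push_cast
    nlinarith

/-- Cauchy estimates for the derivatives of harmonic functions. -/
theorem IsHarm.abs_iterate_dirDeriv_div_factorial_le {v : Euc n → ℝ} (hv : IsHarm v)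
    (e y : Euc n) {T M : ℝ} (hT : 0 < T) (k : ℕ) (hM : ∀ x, ‖x - y‖ ≤ T → |v x| ≤ M) :
    |(dirDeriv e)^[k] v y| / k.factorial ≤ (Real.exp 1 * gradConst n * ‖e‖ / T) ^ k * M := by
  have hM0 : 0 ≤ M := (abs_nonneg _).trans (hM y (by simpa using hT.le))
  rcases Nat.eq_zero_or_pos k with rfl | hk
  · simpa using hM y (by simpa using hT.le)
  have hk' : (0 : ℝ) < k := Nat.cast_pos.2 hk
  -- The radius `T` is shared equally among the `k` derivatives; the resulting `k^k` is absorbed by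
  -- `k^k / k! ≤ e^k`.
  have h1 := hv.abs_iterate_dirDeriv_le e (div_pos hT hk') k y (M := M)
    (fun x hx => hM x (by rwa [mul_div_cancel₀ _ hk'.ne'] at hx))
  have h2 : (k : ℝ) ^ k / k.factorial ≤ Real.exp 1 ^ k := by
    have := Real.pow_div_factorial_le_exp (k : ℝ) hk'.le k
    rwa [← Real.exp_one_pow] at this
  have h3 : (0 : ℝ) < k.factorial := Nat.cast_pos.2 k.factorial_pos
  have hC := gradConst_nonneg n
  calc |(dirDeriv e)^[k] v y| / k.factorial
      ≤ ((gradConst n * ‖e‖ / (T / k)) ^ k * M) / k.factorial := by gcongr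
    _ = (gradConst n * ‖e‖ / T) ^ k * ((k : ℝ) ^ k / k.factorial) * M := by
        rw [div_div_eq_mul_div, mul_div_right_comm _ (k : ℝ) T, mul_pow]
        ring
    _ ≤ (gradConst n * ‖e‖ / T) ^ k * Real.exp 1 ^ k * M := by gcongr
    _ = (Real.exp 1 * gradConst n * ‖e‖ / T) ^ k * M := by
        rw [← mul_pow]
        ring

/-- Taylor's inequality for a sequence of successive derivatives. -/
theorem abs_sub_taylor_le (N : ℕ) : ∀ (f : ℕ → ℝ → ℝ) {B : ℝ},
    (∀ k t, HasDerivAt (f k) (f (k + 1) t) t) → (∀ t ∈ Icc (0 : ℝ) 1, |f N t| ≤ B) →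
    ∀ t ∈ Icc (0 : ℝ) 1, |f 0 t - ∑ j ∈ Finset.range N, f j 0 * (t ^ j / j.factorial)| ≤
      B * (t ^ N / N.factorial) := by
  induction N with
  | zero => intro f B _ hB t ht; simpa using hB t ht
  | succ N ih =>
    intro f B hf hB
    -- The remainder of `f 0` at order `N + 1` has as derivative the remainder of `f 1` at order
    -- `N`; the bound on the latter is integrated.
    have ih' := ih (fun k => f (k + 1)) (B := B) (fun k t => hf (k + 1) t) hB
    have hpow : ∀ (j : ℕ) (t : ℝ), HasDerivAt (fun t : ℝ => t ^ (j + 1) / (j + 1).factorial)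
        (t ^ j / j.factorial) t := fun j t => by
      refine ((hasDerivAt_pow (j + 1) t).div_const _).congr_deriv ?_
      rw [Nat.factorial_succ]
      push_cast
      field_simp
    have hd : ∀ t, HasDerivAt
        (fun t => f 0 t - ∑ j ∈ Finset.range (N + 1), f j 0 * (t ^ j / j.factorial))
        (f 1 t - ∑ j ∈ Finset.range N, f (j + 1) 0 * (t ^ j / j.factorial)) t := fun t => by
      simp_rw [Finset.sum_range_succ']
      refine (hf 0 t).sub ?_
      simpa using HasDerivAt.fun_sum (u := Finset.range N) fun j _ =>
        (hpow j t).const_mul (f (j + 1) 0)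
    intro t ht
    refine image_norm_le_of_norm_deriv_right_le_deriv_boundary (a := 0) (b := 1)
      (f := fun t => f 0 t - ∑ j ∈ Finset.range (N + 1), f j 0 * (t ^ j / j.factorial))
      (B := fun t => B * (t ^ (N + 1) / (N + 1).factorial))
      (fun t _ => (hd t).continuousAt.continuousWithinAt) (fun t _ => (hd t).hasDerivWithinAt)
      ?_ (fun t => (hpow N t).const_mul B) (fun t ht => ih' t ⟨ht.1, ht.2.le⟩) ht
    simp [Finset.sum_range_succ']

theorem dirDeriv_sum_mul {ι : Type*} (s : Finset ι) (c : ι → ℝ) {F : ι → Euc n → ℝ}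
    (hF : ∀ i, Differentiable ℝ (F i)) (e : Euc n) :
    dirDeriv e (fun x => ∑ i ∈ s, c i * F i x) = fun x => ∑ i ∈ s, c i * dirDeriv e (F i) x := by
  funext x
  simp only [dirDeriv]
  rw [fderiv_fun_sum fun i _ => ((hF i) x).const_mul (c i)]
  simp [fderiv_const_mul (hF _ x)]

theorem iterate_dirDeriv_sum_mul {ι : Type*} (s : Finset ι) (c : ι → ℝ) {F : ι → Euc n → ℝ}
    (hF : ∀ i, IsHarm (F i)) (e : Euc n) (k : ℕ) :
    (dirDeriv e)^[k] (fun x => ∑ i ∈ s, c i * F i x) =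
      fun x => ∑ i ∈ s, c i * (dirDeriv e)^[k] (F i) x := by
  induction k with
  | zero => rfl
  | succ k ih =>
    rw [Function.iterate_succ_apply', ih, dirDeriv_sum_mul s c fun i =>
      ((hF i).iterate_dirDeriv e k).contDiff.differentiable two_ne_zero]
    simp only [Function.iterate_succ_apply']

/-- The polynomial `x ↦ (D_x)^k v (0)`. -/
def taylorForm : ℕ → (Euc n → ℝ) → MvPolynomial (Fin n) ℝ
  | 0, v => MvPolynomial.C (v 0)
  | k + 1, v => ∑ i, MvPolynomial.X i * taylorForm k (dirDeriv (basisVec i) v)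

theorem isHomogeneous_taylorForm (k : ℕ) : ∀ v : Euc n → ℝ, (taylorForm k v).IsHomogeneous k := by
  induction k with
  | zero => exact fun v => MvPolynomial.isHomogeneous_C _ _
  | succ k ih =>
    intro v
    refine MvPolynomial.IsHomogeneous.sum _ _ _ fun i _ => ?_
    rw [add_comm]
    exact (MvPolynomial.isHomogeneous_X _ i).mul (ih _)

/-- The direction `x` is frozen during differentiation, so `D_x^(k+1) v = ∑ x_i D_x^k (∂_i v)`,
which is the recursion defining `taylorForm`. -/
theorem IsHarm.ev_taylorForm (k : ℕ) : ∀ {v : Euc n → ℝ}, IsHarm v → ∀ x : Euc n,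
    ev (taylorForm k v) x = (dirDeriv x)^[k] v 0 := by
  induction k with
  | zero => intro v _ x; simp [taylorForm]
  | succ k ih =>
    intro v hv x
    have h : dirDeriv x v = fun y => ∑ i, x i * dirDeriv (basisVec i) v y :=
      funext (dirDeriv_eq_sum v x)
    rw [Function.iterate_succ_apply, h,
      iterate_dirDeriv_sum_mul _ _ fun i => hv.isHarm_dirDeriv (basisVec i)]
    simp only [taylorForm, ev_sum, ev_mul, ev_X, ih (hv.isHarm_dirDeriv _)]

/-- The homogeneous component of degree `k` of the Taylor series of `v` at the origin. -/
def taylorComp (v : Euc n → ℝ) (k : ℕ) : MvPolynomial (Fin n) ℝ :=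
  MvPolynomial.C (k.factorial : ℝ)⁻¹ * taylorForm k v

theorem isHomogeneous_taylorComp (v : Euc n → ℝ) (k : ℕ) : (taylorComp v k).IsHomogeneous k :=
  (isHomogeneous_taylorForm k v).C_mul _

theorem IsHarm.ev_taylorComp {v : Euc n → ℝ} (hv : IsHarm v) (k : ℕ) (x : Euc n) :
    ev (taylorComp v k) x = (dirDeriv x)^[k] v 0 / k.factorial := by
  rw [taylorComp, ev_mul, ev_C, hv.ev_taylorForm, div_eq_inv_mul]

theorem IsHarm.exists_bound {v : Euc n → ℝ} (hv : IsHarm v) (T : ℝ) :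
    ∃ M, 0 ≤ M ∧ ∀ x, ‖x‖ ≤ T → |v x| ≤ M := by
  obtain ⟨M, hM⟩ := (isCompact_closedBall (0 : Euc n) T).exists_bound_of_continuousOn
    hv.contDiff.continuous.continuousOn
  exact ⟨|M|, abs_nonneg _, fun x hx => (hM x (by simpa using hx)).trans (le_abs_self M)⟩

/-- The Taylor components decay faster than any geometric sequence. -/
theorem IsHarm.exists_taylorComp_le {v : Euc n → ℝ} (hv : IsHarm v) {R : ℝ} (hR : 0 < R) (S : ℝ) :
    ∃ M, 0 ≤ M ∧ ∀ k x, ‖x‖ ≤ S → |ev (taylorComp v k) x| ≤ M * R⁻¹ ^ k := by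
  have hC := gradConst_nonneg n
  -- With this radius the ratio in the Cauchy estimate is at most `1/R` for all `‖x‖ ≤ S`; any
  -- radius is allowed because `v` is entire.
  have hT : 0 < 1 + Real.exp 1 * gradConst n * |S| * R := by positivity
  set T := 1 + Real.exp 1 * gradConst n * |S| * R with hTdef
  obtain ⟨M, hM0, hM⟩ := hv.exists_bound T
  refine ⟨M, hM0, fun k x hx => ?_⟩
  have h := hv.abs_iterate_dirDeriv_div_factorial_le x 0 hT k (M := M)
    (fun y hy => hM y (by simpa using hy))
  rw [hv.ev_taylorComp, abs_div, Nat.abs_cast]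
  refine h.trans ?_
  rw [mul_comm]
  gcongr
  rw [div_le_iff₀ hT, inv_mul_eq_div, le_div_iff₀ hR]
  calc Real.exp 1 * gradConst n * ‖x‖ * R ≤ Real.exp 1 * gradConst n * |S| * R := by
        gcongr
        exact hx.trans (le_abs_self S)
    _ ≤ T := by linarith

/-- On the segment from `0` to `x` the Cauchy estimates hold with a radius `T ≥ 2 e C ‖x‖`, where
`C` is `gradConst n`, so the `N`-th Taylor remainder is at most `M 2^(-N)`. -/
theorem IsHarm.hasSum_taylorComp {v : Euc n → ℝ} (hv : IsHarm v) (x : Euc n) :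
    HasSum (fun k => ev (taylorComp v k) x) (v x) := by
  have hC := gradConst_nonneg n
  have hsum : Summable fun k => ev (taylorComp v k) x := by
    obtain ⟨M, -, hM⟩ := hv.exists_taylorComp_le (R := 2) two_pos ‖x‖
    refine Summable.of_norm_bounded (g := fun k => M * (2 : ℝ)⁻¹ ^ k)
      ((summable_geometric_of_lt_one (by norm_num) (by norm_num)).mul_left M)
      fun k => hM k x le_rfl
  rw [hsum.hasSum_iff_tendsto_nat]
  have hT : 0 < 1 + 2 * Real.exp 1 * gradConst n * ‖x‖ := by positivity
  set T := 1 + 2 * Real.exp 1 * gradConst n * ‖x‖ with hTdef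
  obtain ⟨M, hM0, hM⟩ := hv.exists_bound (‖x‖ + T)
  have hder : ∀ k t, HasDerivAt (fun t : ℝ => (dirDeriv x)^[k] v (t • x))
      ((dirDeriv x)^[k + 1] v (t • x)) t := fun k t => by
    rw [Function.iterate_succ_apply']
    have h1 : HasDerivAt (fun t : ℝ => t • x) x t := by
      simpa using (hasDerivAt_id t).smul_const x
    exact (((hv.iterate_dirDeriv x k).contDiff.differentiable two_ne_zero
      (t • x)).hasFDerivAt).comp_hasDerivAt t h1
  have hbound : ∀ N, |v x - ∑ j ∈ Finset.range N, ev (taylorComp v j) x| ≤ M * (1 / 2) ^ N := by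
    intro N
    have hN : (0 : ℝ) < N.factorial := Nat.cast_pos.2 N.factorial_pos
    have h := abs_sub_taylor_le N (fun k t => (dirDeriv x)^[k] v (t • x)) hder
      (B := N.factorial * (M * (1 / 2) ^ N)) (fun t ht => ?_) 1 (by simp)
    · simp only [one_smul, zero_smul, one_pow] at h
      have h2 : ∀ j, ev (taylorComp v j) x = (dirDeriv x)^[j] v 0 * (1 / j.factorial) := fun j => by
        rw [hv.ev_taylorComp, mul_one_div]
      simp_rw [h2]
      refine h.trans_eq ?_
      field_simp
    · have h3 := hv.abs_iterate_dirDeriv_div_factorial_le x (t • x) hT N (M := M)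
        (fun y hy => hM y ?_)
      · rw [div_le_iff₀ hN] at h3
        refine h3.trans ?_
        rw [mul_comm, mul_comm M]
        have h5 : Real.exp 1 * gradConst n * ‖x‖ / T ≤ 1 / 2 := by
          rw [div_le_iff₀ hT, hTdef]
          linarith
        gcongr
      · have h4 : y = (y - t • x) + t • x := by abel
        rw [h4]
        refine (norm_add_le _ _).trans ?_
        rw [norm_smul, Real.norm_of_nonneg ht.1]
        nlinarith [norm_nonneg x, ht.2]
  have hlim : Tendsto (fun N => M * (1 / 2 : ℝ) ^ N) atTop (𝓝 0) := by
    simpa using (tendsto_pow_atTop_nhds_zero_of_lt_one (r := (1 / 2 : ℝ)) (by norm_num)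
      (by norm_num)).const_mul M
  rw [tendsto_iff_norm_sub_tendsto_zero]
  refine squeeze_zero (fun _ => norm_nonneg _) (fun N => ?_) hlim
  rw [norm_sub_rev]
  exact hbound N

/-! ### Growth of products with a polynomial -/

theorem eq_zero_of_eventually_hasSum_pow {c : ℕ → ℝ}
    (h : ∀ᶠ r : ℝ in 𝓝 0, HasSum (fun k => r ^ k * c k) 0) (k : ℕ) : c k = 0 := by
  have h1 : HasFPowerSeriesAt (0 : ℝ → ℝ) (FormalMultilinearSeries.ofScalars ℝ c) 0 := by
    rw [hasFPowerSeriesAt_iff]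
    filter_upwards [h] with r hr
    simpa [FormalMultilinearSeries.coeff_ofScalars] using hr
  have := congrArg (fun p => p.coeff k) h1.eq_zero
  simp only [FormalMultilinearSeries.coeff_ofScalars] at this
  rw [this, FormalMultilinearSeries.coeff]
  simp

theorem coeff_eq_of_forall_hasSum_pow {c : ℕ → ℝ} {p : Polynomial ℝ}
    (h : ∀ r : ℝ, HasSum (fun k => r ^ k * c k) (p.eval r)) (k : ℕ) : p.coeff k = c k := by
  have h1 : ∀ r : ℝ, HasSum (fun k => r ^ k * p.coeff k) (p.eval r) := fun r => by
    rw [Polynomial.eval_eq_sum_range]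
    simp_rw [mul_comm (p.coeff _)]
    refine hasSum_sum_of_ne_finset_zero fun k hk => ?_
    rw [Polynomial.coeff_eq_zero_of_natDegree_lt (by simpa [Nat.lt_succ_iff] using hk), mul_zero]
  have := eq_zero_of_eventually_hasSum_pow (c := fun k => p.coeff k - c k)
    (Eventually.of_forall fun r => by simpa [mul_sub] using (h1 r).sub (h r)) k
  exact sub_eq_zero.1 this

/-- Weighted moments of a harmonic function, with the coefficients in terms of its Taylor
components. -/
theorem IsHarm.exists_moment_polynomial_coeff {v : Euc n → ℝ} (hv : IsHarm v)
    (q : MvPolynomial (Fin n) ℝ) :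
    ∃ p : Polynomial ℝ, p.natDegree ≤ q.totalDegree ∧
      (∀ r : ℝ, ∫ x, bump (‖x‖ ^ 2) * (v (r • x) * ev q x) = p.eval r) ∧
      ∀ k, p.coeff k = ∫ x, bump (‖x‖ ^ 2) * (ev (taylorComp v k) x * ev q x) := by
  obtain ⟨p, hp, hpr⟩ := IsHarm.exists_moment_polynomial _ q le_rfl bump isProfile_bump v hv
  refine ⟨p, hp, hpr, coeff_eq_of_forall_hasSum_pow fun r => ?_⟩
  rw [← hpr r]
  -- Decay at rate `2|r| + 1` beats `|r|^k` by `2^(-k)`, which dominates the series and allows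
  -- summation under the integral.
  obtain ⟨M, hM0, hM⟩ := hv.exists_taylorComp_le (R := 2 * |r| + 1) (by positivity) 1
  have hratio : |r| * (2 * |r| + 1)⁻¹ ≤ 1 / 2 := by
    rw [← div_eq_mul_inv, div_le_iff₀ (by positivity)]
    linarith
  have hgeo : Summable fun k : ℕ => M * (1 / 2 : ℝ) ^ k :=
    (summable_geometric_of_lt_one (by norm_num) (by norm_num)).mul_left M
  simp_rw [← integral_const_mul]
  refine hasSum_integral_of_dominated_convergence
    (fun k x => M * (1 / 2 : ℝ) ^ k * (bump (‖x‖ ^ 2) * |ev q x|))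
    (fun k => ((integrable_bump_mul ((continuous_ev _).mul
      (continuous_ev _))).const_mul _).aestronglyMeasurable)
    (fun k => Eventually.of_forall fun x => ?_) (Eventually.of_forall fun x => hgeo.mul_right _)
    ?_ (Eventually.of_forall fun x => ?_)
  · by_cases hx : ‖x‖ < 1
    · rw [norm_mul, norm_mul, norm_mul, norm_pow, Real.norm_eq_abs, Real.norm_eq_abs,
        Real.norm_eq_abs, Real.norm_eq_abs, abs_of_nonneg (bump_nonneg _)]
      have h1 := hM k x hx.le
      have h2 : |r| ^ k * |ev (taylorComp v k) x| ≤ M * (1 / 2) ^ k :=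
        calc |r| ^ k * |ev (taylorComp v k) x| ≤ |r| ^ k * (M * (2 * |r| + 1)⁻¹ ^ k) := by gcongr
          _ = M * (|r| * (2 * |r| + 1)⁻¹) ^ k := by rw [mul_pow]; ring
          _ ≤ M * (1 / 2) ^ k := by gcongr
      calc |r| ^ k * (bump (‖x‖ ^ 2) * (|ev (taylorComp v k) x| * |ev q x|))
          = (|r| ^ k * |ev (taylorComp v k) x|) * (bump (‖x‖ ^ 2) * |ev q x|) := by ring
        _ ≤ _ := mul_le_mul_of_nonneg_right h2 (mul_nonneg (bump_nonneg _) (abs_nonneg _))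
    · simp [isProfile_bump.weight_eq_zero (not_lt.1 hx)]
  · simp_rw [tsum_mul_right]
    exact (integrable_bump_mul (continuous_ev q).abs).const_mul _
  · have h := ((hv.hasSum_taylorComp (r • x)).mul_right (ev q x)).mul_left (bump (‖x‖ ^ 2))
    refine h.congr_fun fun k => ?_
    rw [ev_smul_of_isHomogeneous (isHomogeneous_taylorComp v k)]
    ring

/-- `r^M √r` is negligible against `r^(M+1)`, so degree above `M` is excluded even if the bound
holds only along a sequence of radii. This slack of half a power is what the exponent `β = 1/2`
uses. -/
theorem natDegree_le_of_frequently_le {P : Polynomial ℝ} {M : ℕ} {C : ℝ}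
    (h : ∃ᶠ r : ℝ in atTop, |P.eval r| ≤ C * (r ^ M * √r)) : P.natDegree ≤ M := by
  by_contra! hlt
  have hP : P ≠ 0 := by
    rintro rfl
    simp at hlt
  have h1 : Tendsto (fun r : ℝ => P.eval r / r ^ P.natDegree) atTop (𝓝 P.leadingCoeff) := by
    have := Polynomial.div_tendsto_atTop_leadingCoeff_div_of_degree_eq P
      (Polynomial.X ^ P.natDegree)
      (by rw [Polynomial.degree_X_pow, Polynomial.degree_eq_natDegree hP])
    simpa using this
  have hl : 0 < |P.leadingCoeff| := abs_pos.2 (Polynomial.leadingCoeff_ne_zero.2 hP)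
  have h2 : Tendsto (fun r : ℝ => |C| * (√r)⁻¹) atTop (𝓝 0) := by
    simpa using (tendsto_inv_atTop_zero.comp Real.tendsto_sqrt_atTop).const_mul |C|
  obtain ⟨r, hr, h3, h4, h5⟩ := (h.and_eventually ((h1.abs.eventually (lt_mem_nhds
    (half_lt_self hl))).and ((h2.eventually (gt_mem_nhds (half_pos hl))).and
      (eventually_ge_atTop 1)))).exists
  have hr0 : 0 < r := by linarith
  have hs : 0 < √r := Real.sqrt_pos.2 hr0
  rw [abs_div, abs_of_pos (pow_pos hr0 _), lt_div_iff₀ (pow_pos hr0 _)] at h3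
  have h6 : r ^ M * √r * √r ≤ r ^ P.natDegree := by
    rw [mul_assoc, Real.mul_self_sqrt hr0.le, ← pow_succ]
    exact pow_le_pow_right₀ h5 hlt
  have h7 : C * (r ^ M * √r) ≤ |C| * (√r)⁻¹ * r ^ P.natDegree := by
    calc C * (r ^ M * √r) ≤ |C| * (r ^ M * √r) := by gcongr; exact le_abs_self C
      _ = |C| * (√r)⁻¹ * (r ^ M * √r * √r) := by field_simp
      _ ≤ _ := by gcongr
  have h8 := mul_lt_mul_of_pos_right h4 (pow_pos hr0 P.natDegree)
  linarith

/-- A sequence decaying faster than any geometric one which satisfies a linear recurrence relation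
with constant coefficients from some index on vanishes from that index on. -/
theorem eq_zero_of_recurrence {c b : ℕ → ℝ} {d K : ℕ} (hc : c d ≠ 0)
    (hb : ∀ R : ℝ, 0 < R → ∃ A, 0 ≤ A ∧ ∀ k, |b k| ≤ A * R⁻¹ ^ k)
    (h : ∀ k, K < k → ∑ j ∈ Finset.range (d + 1), c j * b (k + d - j) = 0) {k : ℕ} (hk : K < k) :
    b k = 0 := by
  set S := ∑ j ∈ Finset.range d, |c j| with hS
  have hS0 : 0 ≤ S := Finset.sum_nonneg fun _ _ => abs_nonneg _
  have hcd : 0 < |c d| := abs_pos.2 hc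
  set R := 1 + 2 * S / |c d| with hR
  have hR1 : 1 ≤ R := by
    rw [hR]
    have : 0 ≤ 2 * S / |c d| := by positivity
    linarith
  have hR0 : 0 < R := by linarith
  have hRi : R⁻¹ ≤ 1 := inv_le_one_of_one_le₀ hR1
  have hSR : S * R⁻¹ ≤ |c d| / 2 := by
    rw [← div_eq_mul_inv, div_le_iff₀ hR0, hR]
    have : |c d| / 2 * (1 + 2 * S / |c d|) = |c d| / 2 + S := by field_simp
    linarith
  obtain ⟨A, hA0, hA⟩ := hb R hR0
  have key : ∀ i k, K < k → |b k| ≤ A * (1 / 2) ^ i * R⁻¹ ^ k := by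
    intro i
    induction i with
    | zero => intro k _; simpa using hA k
    | succ i ih =>
      intro k hk
      have h1 := h k hk
      rw [Finset.sum_range_succ, Nat.add_sub_cancel] at h1
      have h2 : |c d| * |b k| ≤ ∑ j ∈ Finset.range d, |c j| * |b (k + d - j)| := by
        have : c d * b k = -∑ j ∈ Finset.range d, c j * b (k + d - j) := by linarith
        rw [← abs_mul, this, abs_neg]
        refine (Finset.abs_sum_le_sum_abs _ _).trans (Finset.sum_le_sum fun j _ => ?_)
        rw [abs_mul]
      have h3 : ∑ j ∈ Finset.range d, |c j| * |b (k + d - j)| ≤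
          S * (A * (1 / 2) ^ i * R⁻¹ ^ (k + 1)) := by
        rw [hS, Finset.sum_mul]
        refine Finset.sum_le_sum fun j hj => ?_
        have hj' := Finset.mem_range.1 hj
        refine mul_le_mul_of_nonneg_left ((ih (k + d - j) (by omega)).trans ?_) (abs_nonneg _)
        refine mul_le_mul_of_nonneg_left ?_ (by positivity)
        exact pow_le_pow_of_le_one (by positivity) hRi (by omega)
      have h4 : |c d| * |b k| ≤ |c d| * (A * (1 / 2) ^ (i + 1) * R⁻¹ ^ k) :=
        calc |c d| * |b k| ≤ S * (A * (1 / 2) ^ i * R⁻¹ ^ (k + 1)) := h2.trans h3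
          _ = (S * R⁻¹) * (A * (1 / 2) ^ i * R⁻¹ ^ k) := by rw [pow_succ]; ring
          _ ≤ (|c d| / 2) * (A * (1 / 2) ^ i * R⁻¹ ^ k) :=
            mul_le_mul_of_nonneg_right hSR (by positivity)
          _ = _ := by rw [pow_succ]; ring
      exact le_of_mul_le_mul_left h4 hcd
  have hlim : Tendsto (fun i : ℕ => A * (1 / 2 : ℝ) ^ i * R⁻¹ ^ k) atTop (𝓝 0) := by
    simpa using ((tendsto_pow_atTop_nhds_zero_of_lt_one (r := (1 / 2 : ℝ)) (by norm_num)
      (by norm_num)).const_mul A).mul_const (R⁻¹ ^ k)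
  exact abs_eq_zero.1 (le_antisymm (ge_of_tendsto' hlim fun i => key i k hk) (abs_nonneg _))

theorem ev_smul_eq_sum (U : MvPolynomial (Fin n) ℝ) (r : ℝ) (x : Euc n) :
    ev U (r • x) = ∑ j ∈ Finset.range (U.totalDegree + 1),
      r ^ j * ev (MvPolynomial.homogeneousComponent j U) x := by
  conv_lhs => rw [← MvPolynomial.sum_homogeneousComponent U]
  rw [ev_sum]
  exact Finset.sum_congr rfl fun j _ =>
    ev_smul_of_isHomogeneous (MvPolynomial.homogeneousComponent_isHomogeneous j U) r x

theorem homogeneousComponent_totalDegree_ne_zero {U : MvPolynomial (Fin n) ℝ} (hU : U ≠ 0) :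
    MvPolynomial.homogeneousComponent U.totalDegree U ≠ 0 := by
  obtain ⟨s, hs, hd⟩ := Finset.exists_mem_eq_sup U.support
    (MvPolynomial.support_nonempty.2 hU) (fun s => s.sum fun _ e => e)
  intro h
  have h1 : MvPolynomial.coeff s (MvPolynomial.homogeneousComponent U.totalDegree U) = 0 := by
    rw [h, MvPolynomial.coeff_zero]
  rw [MvPolynomial.coeff_homogeneousComponent, if_pos] at h1
  · exact MvPolynomial.mem_support_iff.1 hs h1
  · exact hd.symm

theorem exists_ev_bound (q : MvPolynomial (Fin n) ℝ) :
    ∃ B, 0 ≤ B ∧ ∀ x, ‖x‖ ≤ 1 → |ev q x| ≤ B := by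
  obtain ⟨M, hM⟩ := (isCompact_closedBall (0 : Euc n) 1).exists_bound_of_continuousOn
    (continuous_ev q).continuousOn
  exact ⟨|M|, abs_nonneg _, fun x hx => (hM x (by simpa using hx)).trans (le_abs_self M)⟩

/-- Weighted moments of the product of a polynomial and a harmonic function. -/
theorem IsHarm.exists_product_moment_polynomial {v : Euc n → ℝ} (hv : IsHarm v)
    (U q : MvPolynomial (Fin n) ℝ) :
    ∃ P : Polynomial ℝ, P.natDegree ≤ 2 * U.totalDegree + q.totalDegree ∧
      (∀ r : ℝ, ∫ x, bump (‖x‖ ^ 2) * (ev U (r • x) * v (r • x) * ev q x) = P.eval r) ∧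
      ∀ k, P.coeff (k + U.totalDegree) = ∫ x, bump (‖x‖ ^ 2) *
        (ev (∑ j ∈ Finset.range (U.totalDegree + 1), MvPolynomial.homogeneousComponent j U *
          taylorComp v (k + U.totalDegree - j)) x * ev q x) := by
  choose p hpd hpr hpc using fun j => hv.exists_moment_polynomial_coeff
    (MvPolynomial.homogeneousComponent j U * q)
  -- Expand `U(rx) = ∑ r^j U_j(x)`: the `j`-th term is `r^j` times a moment against `U_j q`, of
  -- degree at most `2j + deg q`. In the last claim the index is shifted by `deg U` so that the
  -- subtraction of `j` never truncates.
  refine ⟨∑ j ∈ Finset.range (U.totalDegree + 1), Polynomial.X ^ j * p j, ?_, fun r => ?_,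
    fun k => ?_⟩
  · refine Polynomial.natDegree_sum_le_of_forall_le _ _ fun j hj => ?_
    have hj' := Finset.mem_range.1 hj
    have h1 := (hpd j).trans (MvPolynomial.totalDegree_mul _ _)
    have h2 := (MvPolynomial.homogeneousComponent_isHomogeneous j U).totalDegree_le
    refine Polynomial.natDegree_mul_le.trans ?_
    rw [Polynomial.natDegree_X_pow]
    omega
  · have hc : ∀ j, Continuous fun x : Euc n =>
        v (r • x) * ev (MvPolynomial.homogeneousComponent j U * q) x := fun j =>
      (hv.contDiff.continuous.comp (by fun_prop)).mul (continuous_ev _)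
    simp only [Polynomial.eval_finsetSum, Polynomial.eval_mul, Polynomial.eval_pow,
      Polynomial.eval_X, ← hpr, ← integral_const_mul]
    rw [← integral_finsetSum _ fun j _ => (integrable_bump_mul (hc j)).const_mul _]
    refine integral_congr_ae (Eventually.of_forall fun x => ?_)
    simp only [ev_smul_eq_sum U, ev_mul, Finset.sum_mul, Finset.mul_sum]
    exact Finset.sum_congr rfl fun j _ => by ring
  · have hc : ∀ j, Continuous fun x : Euc n => ev (taylorComp v (k + U.totalDegree - j)) x *
        ev (MvPolynomial.homogeneousComponent j U * q) x := fun j =>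
      (continuous_ev _).mul (continuous_ev _)
    rw [Polynomial.finsetSum_coeff]
    have h1 : ∀ j ∈ Finset.range (U.totalDegree + 1),
        (Polynomial.X ^ j * p j).coeff (k + U.totalDegree) = ∫ x, bump (‖x‖ ^ 2) *
          (ev (taylorComp v (k + U.totalDegree - j)) x *
            ev (MvPolynomial.homogeneousComponent j U * q) x) := fun j hj => by
      have hj' := Finset.mem_range.1 hj
      rw [Polynomial.coeff_X_pow_mul', if_pos (by omega), hpc]
    rw [Finset.sum_congr rfl h1, ← integral_finsetSum _ fun j _ => integrable_bump_mul (hc j)]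
    refine integral_congr_ae (Eventually.of_forall fun x => ?_)
    simp only [ev_sum, ev_mul, Finset.sum_mul, Finset.mul_sum]
    exact Finset.sum_congr rfl fun j _ => by ring

/-- If the product of an entire harmonic function and a polynomial has polynomial growth in the
mean along a sequence of radii, then the harmonic function is a polynomial. -/
theorem IsHarm.exists_polynomial_of_growth {v : Euc n → ℝ} (hv : IsHarm v)
    {U : MvPolynomial (Fin n) ℝ} (hU : U ≠ 0) {M : ℕ} (hM : U.totalDegree ≤ M) {C : ℝ}
    (h : ∃ᶠ r : ℝ in atTop,
      ∫ x, bump (‖x‖ ^ 2) * |ev U (r • x) * v (r • x)| ≤ C * (r ^ M * √r)) :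
    ∃ V : MvPolynomial (Fin n) ℝ, (∀ x, v x = ev V x) ∧
      V.totalDegree ≤ M - U.totalDegree := by
  set d := U.totalDegree with hd
  -- The homogeneous part of degree `k + d` of the Taylor series of `U v`.
  set G : ℕ → MvPolynomial (Fin n) ℝ := fun k => ∑ j ∈ Finset.range (d + 1),
    MvPolynomial.homogeneousComponent j U * taylorComp v (k + d - j) with hG
  -- Test against `G k` itself: the growth bound limits the moment polynomial to degree `M`, while
  -- its coefficient of degree `k + d > M` is the weighted `L²` norm squared of `G k`.
  have hG0 : ∀ k, M - d < k → G k = 0 := by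
    intro k hk
    obtain ⟨P, -, hPr, hPc⟩ := hv.exists_product_moment_polynomial U (G k)
    obtain ⟨B, hB0, hB⟩ := exists_ev_bound (G k)
    have hdeg : P.natDegree ≤ M := by
      refine natDegree_le_of_frequently_le (C := B * C) (h.mono fun r hr => ?_)
      have hc : Continuous fun x : Euc n => ev U (r • x) * v (r • x) :=
        ((continuous_ev U).comp (by fun_prop)).mul (hv.contDiff.continuous.comp (by fun_prop))
      rw [← hPr r, mul_assoc]
      refine abs_integral_le_integral_abs.trans ((integral_mono (integrable_bump_mul
        (hc.mul (continuous_ev _))).abs ((integrable_bump_mul hc.abs).const_mul B)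
        fun x => ?_).trans ?_)
      · simp only [abs_mul, abs_of_nonneg (bump_nonneg _), Pi.mul_apply]
        by_cases hx : ‖x‖ < 1
        · have := mul_le_mul_of_nonneg_left (hB x hx.le)
            (mul_nonneg (bump_nonneg (‖x‖ ^ 2)) (abs_nonneg (ev U (r • x) * v (r • x))))
          rw [abs_mul] at this
          linarith
        · simp [isProfile_bump.weight_eq_zero (not_lt.1 hx)]
      · rw [integral_const_mul]
        exact mul_le_mul_of_nonneg_left hr hB0
    have h0 : ∫ x, bump (‖x‖ ^ 2) * (ev (G k) x * ev (G k) x) = 0 := by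
      rw [← hPc k]
      exact Polynomial.coeff_eq_zero_of_natDegree_lt (by omega)
    have h1 : ∀ x : Euc n, ‖x‖ < 1 → ev (G k) x = 0 := fun x hx => by
      have := eq_zero_of_integral_bump_mul_eq_zero ((continuous_ev (G k)).mul (continuous_ev (G k)))
        (fun x _ => mul_self_nonneg _) h0 hx
      exact mul_self_eq_zero.1 this
    have hhom : (G k).IsHomogeneous (k + d) := by
      refine MvPolynomial.IsHomogeneous.sum _ _ _ fun j hj => ?_
      have hj' := Finset.mem_range.1 hj
      have := (MvPolynomial.homogeneousComponent_isHomogeneous j U).mul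
        (isHomogeneous_taylorComp v (k + d - j))
      rwa [show j + (k + d - j) = k + d by omega] at this
    refine ext_of_ev fun x => ?_
    have hx : ‖(‖x‖ + 1)⁻¹ • x‖ < 1 := by
      rw [norm_smul, norm_inv, Real.norm_of_nonneg (by positivity), inv_mul_lt_iff₀ (by positivity)]
      linarith
    have h2 := h1 _ hx
    rw [ev_smul_of_isHomogeneous hhom, mul_eq_zero] at h2
    rw [ev_zero]
    exact h2.resolve_left (by positivity)
  -- Where the top form `U_d` is nonzero at `x`, the vanishing of the `G k` is a recurrence for the
  -- values at `x` of the Taylor components of `v`, with coefficient `U_d(x)` at the lowest index;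
  -- elsewhere the product below is zero anyway.
  have ha0 : ∀ k, M - d < k → taylorComp v k = 0 := by
    intro k hk
    have : MvPolynomial.homogeneousComponent d U * taylorComp v k = 0 := by
      refine ext_of_ev fun x => ?_
      rw [ev_mul, ev_zero, mul_eq_zero, or_iff_not_imp_left]
      intro hx
      refine eq_zero_of_recurrence (c := fun j => ev (MvPolynomial.homogeneousComponent j U) x)
        (b := fun k => ev (taylorComp v k) x) hx (fun R hR => ?_) (fun k hk => ?_) hk
      · obtain ⟨A, hA, h⟩ := hv.exists_taylorComp_le hR ‖x‖
        exact ⟨A, hA, fun k => h k x le_rfl⟩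
      · have := congrArg (fun p => ev p x) (hG0 k hk)
        simpa only [hG, ev_sum, ev_mul, ev_zero] using this
    exact (mul_eq_zero.1 this).resolve_left (homogeneousComponent_totalDegree_ne_zero hU)
  refine ⟨∑ k ∈ Finset.range (M - d + 1), taylorComp v k, fun x => ?_, ?_⟩
  · rw [ev_sum]
    refine (hv.hasSum_taylorComp x).unique (hasSum_sum_of_ne_finset_zero fun k hk => ?_)
    rw [ha0 k (by simpa [Nat.lt_succ_iff] using hk), ev_zero]
  · refine MvPolynomial.totalDegree_finsetSum_le fun k hk => ?_
    exact (isHomogeneous_taylorComp v k).totalDegree_le.trans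
      (Nat.lt_succ_iff.1 (Finset.mem_range.1 hk))

/-! ### Passing to the fraction field -/

section Gauss

open Polynomial nonZeroDivisors

variable {A : Type*} [CommRing A]

theorem isUnit_of_associated_map {p : A[X]} {π : (FractionRing A)[X]}
    (h : Associated (p.map (algebraMap A (FractionRing A))) π) (hp : IsUnit p) : IsUnit π :=
  h.isUnit (hp.map (mapRingHom (algebraMap A (FractionRing A))))

variable [IsDomain A]

/-- Clear denominators in a Bézout identity over the fraction field; `D` then plays the role of a
resultant. -/
theorem exists_bezout_of_isCoprime_map {P Q : A[X]}
    (h : IsCoprime (P.map (algebraMap A (FractionRing A)))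
      (Q.map (algebraMap A (FractionRing A)))) :
    ∃ (a b : A[X]) (D : A), D ≠ 0 ∧ a * P + b * Q = C D := by
  obtain ⟨a, b, hab⟩ := h
  obtain ⟨s, hs, hsa⟩ := IsLocalization.integerNormalization_spec A⁰ a
  obtain ⟨t, ht, htb⟩ := IsLocalization.integerNormalization_spec A⁰ b
  refine ⟨C t * IsLocalization.integerNormalization A⁰ a,
    C s * IsLocalization.integerNormalization A⁰ b, s * t,
    mul_ne_zero (nonZeroDivisors.ne_zero hs) (nonZeroDivisors.ne_zero ht), ?_⟩
  apply map_injective _ (IsFractionRing.injective A (FractionRing A))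
  have h2 : ∀ (c : A) (π : (FractionRing A)[X]),
      c • π = C (algebraMap A (FractionRing A) c) * π := fun c π => by
    rw [← smul_eq_C_mul, algebraMap_smul]
  simp only [Polynomial.map_add, Polynomial.map_mul, map_C, hsa, htb, h2, map_mul]
  linear_combination C (algebraMap A (FractionRing A) s) * C (algebraMap A (FractionRing A) t) * hab

variable [UniqueFactorizationMonoid A]

/-- Every nonzero polynomial over the fraction field of `A` is associated to a polynomial over `A`
for which divisibility over `A` and over the fraction field agree, together with its square. -/
theorem exists_primitive_associated {π : (FractionRing A)[X]} (hπ : π ≠ 0) :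
    ∃ p : A[X], Associated (p.map (algebraMap A (FractionRing A))) π ∧
      (∀ P : A[X], π ∣ P.map (algebraMap A (FractionRing A)) → p ∣ P) ∧
      ∀ P : A[X], π * π ∣ P.map (algebraMap A (FractionRing A)) → p * p ∣ P := by
  let : StrongNormalizationMonoid A := UniqueFactorizationMonoid.strongNormalizationMonoid
  let : NormalizedGCDMonoid A := UniqueFactorizationMonoid.toNormalizedGCDMonoid A
  obtain ⟨b, hb, hbπ⟩ := IsLocalization.integerNormalization_spec A⁰ π
  set q := IsLocalization.integerNormalization A⁰ π with hq
  have hq0 : q ≠ 0 := fun h => hπ (IsFractionRing.integerNormalization_eq_zero_iff.1 h)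
  have hunit : ∀ a : A, a ≠ 0 → IsUnit (C (algebraMap A (FractionRing A) a)) := fun a ha =>
    isUnit_C.2 (IsUnit.mk0 _
      ((map_ne_zero_iff _ (IsFractionRing.injective A (FractionRing A))).2 ha))
  have hass : Associated (q.primPart.map (algebraMap A (FractionRing A))) π := by
    have h1 : q.map (algebraMap A (FractionRing A)) = C (algebraMap A (FractionRing A) q.content) *
        q.primPart.map (algebraMap A (FractionRing A)) := by
      conv_lhs => rw [q.eq_C_content_mul_primPart]
      rw [Polynomial.map_mul, map_C]
    have h2 : b • π = C (algebraMap A (FractionRing A) b) * π := by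
      rw [← smul_eq_C_mul, algebraMap_smul]
    rw [h1, h2] at hbπ
    have e1 : Associated (q.primPart.map (algebraMap A (FractionRing A)))
        (C (algebraMap A (FractionRing A) q.content) *
          q.primPart.map (algebraMap A (FractionRing A))) :=
      (associated_unit_mul_left _ _ (hunit _ (by rwa [Ne, content_eq_zero_iff]))).symm
    have e2 : Associated (C (algebraMap A (FractionRing A) b) * π) π :=
      associated_unit_mul_left _ _ (hunit b (nonZeroDivisors.ne_zero hb))
    exact e1.trans (hbπ ▸ e2)
  have hprim := isPrimitive_primPart q
  -- Gauss's lemma: divisibility by a primitive polynomial descends from the fraction field to `A`,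
  -- and a product of primitive polynomials is primitive.
  refine ⟨q.primPart, hass, fun P hP => ?_, fun P hP => ?_⟩
  · exact hprim.dvd_of_fraction_map_dvd_fraction_map (hass.dvd.trans hP)
  · refine (hprim.mul hprim).dvd_of_fraction_map_dvd_fraction_map (K := FractionRing A) ?_
    rw [Polynomial.map_mul]
    exact (mul_dvd_mul hass.dvd hass.dvd).trans hP

/-- A primitive representative of the gcd over the fraction field already divides `P` and `Q` over
`A`. If the gcd is 0, both vanish and the nonunit `X` is a common divisor. -/
theorem isCoprime_map_of_isRelPrime {P Q : A[X]} (h : IsRelPrime P Q) :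
    IsCoprime (P.map (algebraMap A (FractionRing A))) (Q.map (algebraMap A (FractionRing A))) := by
  classical
  rw [← EuclideanDomain.gcd_isUnit_iff]
  by_cases h0 : EuclideanDomain.gcd (P.map (algebraMap A (FractionRing A)))
      (Q.map (algebraMap A (FractionRing A))) = 0
  · obtain ⟨hP, hQ⟩ := EuclideanDomain.gcd_eq_zero_iff.1 h0
    rw [Polynomial.map_eq_zero_iff (IsFractionRing.injective A (FractionRing A))] at hP hQ
    subst hP hQ
    exact absurd (h (dvd_zero X) (dvd_zero X)) not_isUnit_X
  · obtain ⟨p, hp, hdvd, -⟩ := exists_primitive_associated h0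
    exact isUnit_of_associated_map hp (h (hdvd P (EuclideanDomain.gcd_dvd_left _ _))
      (hdvd Q (EuclideanDomain.gcd_dvd_right _ _)))

theorem squarefree_map_of_squarefree {P : A[X]} (h : Squarefree P) :
    Squarefree (P.map (algebraMap A (FractionRing A))) := by
  intro π hπ
  have hP : P.map (algebraMap A (FractionRing A)) ≠ 0 := by
    rw [Polynomial.map_ne_zero_iff (IsFractionRing.injective A (FractionRing A))]
    exact h.ne_zero
  have hπ0 : π ≠ 0 := by
    rintro rfl
    rw [mul_zero, zero_dvd_iff] at hπ
    exact hP hπ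
  obtain ⟨p, hp, -, hdvd⟩ := exists_primitive_associated hπ0
  exact isUnit_of_associated_map hp (h p (hdvd P hπ))

end Gauss

/-! ### Restriction to generic lines -/

section Lines

open Polynomial

/-- The substitution `x ↦ x + t e` on polynomials, as a homomorphism to `ℝ[x][t]`. -/
def shiftHom (e : Fin n → ℝ) : MvPolynomial (Fin n) ℝ →+* (MvPolynomial (Fin n) ℝ)[X] :=
  MvPolynomial.eval₂Hom (C.comp MvPolynomial.C)
    fun i => C (MvPolynomial.X i) + C (MvPolynomial.C (e i)) * X

/-- The endomorphism `(x, t) ↦ (x + t e, t)` of `ℝ[x][t]`. -/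
def shearHom (e : Fin n → ℝ) : (MvPolynomial (Fin n) ℝ)[X] →+* (MvPolynomial (Fin n) ℝ)[X] :=
  eval₂RingHom (shiftHom e) X

theorem shearHom_C (e : Fin n → ℝ) (p : MvPolynomial (Fin n) ℝ) :
    shearHom e (C p) = shiftHom e p := by simp [shearHom]

theorem shearHom_comp_neg (e : Fin n → ℝ) : (shearHom e).comp (shearHom (-e)) = RingHom.id _ := by
  refine Polynomial.ringHom_ext' (MvPolynomial.ringHom_ext (fun r => ?_) fun i => ?_) ?_
  · simp [shearHom, shiftHom]
  · simp [shearHom, shiftHom]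
    ring
  · simp [shearHom]

theorem shearHom_neg_apply (e : Fin n → ℝ) (p : (MvPolynomial (Fin n) ℝ)[X]) :
    shearHom e (shearHom (-e) p) = p :=
  RingHom.congr_fun (shearHom_comp_neg e) p

theorem shearHom_apply_neg (e : Fin n → ℝ) (p : (MvPolynomial (Fin n) ℝ)[X]) :
    shearHom (-e) (shearHom e p) = p := by
  simpa using shearHom_neg_apply (-e) p

theorem dvd_of_C_dvd_C {A : Type*} [CommRing A] {a b : A} (h : (C a : A[X]) ∣ C b) : a ∣ b := by
  simpa using C_dvd_iff_dvd_coeff a (C b) |>.1 h 0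

theorem exists_eq_C_of_dvd_C {A : Type*} [CommRing A] [IsDomain A] {P : A} (hP : P ≠ 0) {p : A[X]}
    (h : p ∣ C P) : ∃ c, p = C c ∧ c ∣ P := by
  have hdeg : p.natDegree = 0 := by
    have := natDegree_le_of_dvd h (C_ne_zero.2 hP)
    simpa using this
  obtain ⟨c, rfl⟩ := natDegree_eq_zero.1 hdeg
  exact ⟨c, rfl, dvd_of_C_dvd_C h⟩

/-- The shear is an automorphism of `ℝ[x][t]`. Sheared back, a common factor divides `P` and `Q`
viewed as constants in `t`, so it is itself constant in `t` and a unit. -/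
theorem isRelPrime_shiftHom {P Q : MvPolynomial (Fin n) ℝ} (hP : P ≠ 0) (h : IsRelPrime P Q)
    (e : Fin n → ℝ) : IsRelPrime (shiftHom e P) (shiftHom e Q) := by
  intro p hpP hpQ
  rw [← shearHom_C] at hpP hpQ
  have h1 := map_dvd (shearHom (-e)) hpP
  have h2 := map_dvd (shearHom (-e)) hpQ
  rw [shearHom_apply_neg] at h1 h2
  obtain ⟨c, hc, hcP⟩ := exists_eq_C_of_dvd_C hP h1
  rw [hc] at h2
  have := (h hcP (dvd_of_C_dvd_C h2)).map (C : _ →+* (MvPolynomial (Fin n) ℝ)[X])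
  rw [← hc] at this
  simpa [shearHom_neg_apply] using this.map (shearHom e)

theorem squarefree_shiftHom {P : MvPolynomial (Fin n) ℝ} (h : Squarefree P) (e : Fin n → ℝ) :
    Squarefree (shiftHom e P) := by
  intro p hp
  rw [← shearHom_C] at hp
  have h1 := map_dvd (shearHom (-e)) hp
  rw [shearHom_apply_neg, map_mul] at h1
  obtain ⟨c, hc, -⟩ := exists_eq_C_of_dvd_C h.ne_zero ((dvd_mul_right _ _).trans h1)
  rw [hc, ← C_mul] at h1
  have := (h c (dvd_of_C_dvd_C h1)).map (C : _ →+* (MvPolynomial (Fin n) ℝ)[X])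
  rw [← hc] at this
  simpa [shearHom_neg_apply] using this.map (shearHom e)

/-- The restriction of a polynomial to the line `t ↦ x + t e`. -/
theorem eval_map_shiftHom (e x : Euc n) (t : ℝ) (P : MvPolynomial (Fin n) ℝ) :
    ((shiftHom e P).map (MvPolynomial.eval fun i => x i)).eval t = ev P (x + t • e) := by
  induction P using MvPolynomial.induction_on with
  | C a => simp [shiftHom]
  | add p q hp hq => simp [hp, hq]
  | mul_X p i hp =>
    rw [map_mul, Polynomial.map_mul, eval_mul, hp, ev_mul, ev_X]
    simp [shiftHom]
    ring_nf
    simp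

/-- Bézout in `t` gives `a P(x + te) + b Q(x + te) = D(x)` with `D ≠ 0`; a common zero on the line
through `x` forces `D(x) = 0`. -/
theorem exists_forall_line_not_common_zero {P Q : MvPolynomial (Fin n) ℝ} (hP : P ≠ 0)
    (h : IsRelPrime P Q) (e : Euc n) : ∃ D : MvPolynomial (Fin n) ℝ, D ≠ 0 ∧
      ∀ x, ev D x ≠ 0 → ∀ t : ℝ, ev P (x + t • e) = 0 → ev Q (x + t • e) ≠ 0 := by
  obtain ⟨a, b, D, hD, hab⟩ := exists_bezout_of_isCoprime_map
    (isCoprime_map_of_isRelPrime (isRelPrime_shiftHom hP h e))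
  refine ⟨D, hD, fun x hx t h1 h2 => hx ?_⟩
  have := congrArg (fun p => (p.map (MvPolynomial.eval fun i => x i)).eval t) hab
  simp only [Polynomial.map_add, Polynomial.map_mul, eval_add, eval_mul, eval_map_shiftHom, h1, h2,
    map_C, eval_C, mul_zero, add_zero] at this
  exact this.symm

theorem hasDerivAt_comp_line {F : Euc n → ℝ} (hF : Differentiable ℝ F) (x e : Euc n) (t : ℝ) :
    HasDerivAt (fun t : ℝ => F (x + t • e)) (dirDeriv e F (x + t • e)) t := by
  have h : HasDerivAt (fun s : ℝ => x + s • e) e t := by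
    simpa using ((hasDerivAt_id t).smul_const e).const_add x
  exact ((hF (x + t • e)).hasFDerivAt).comp_hasDerivAt t h

/-- The same elimination applied to `P(x + te)` and its `t`-derivative, which are coprime over the
fraction field because squarefree means separable in characteristic zero. -/
theorem exists_forall_line_simple_zero {P : MvPolynomial (Fin n) ℝ} (h : Squarefree P)
    (e : Euc n) : ∃ D : MvPolynomial (Fin n) ℝ, D ≠ 0 ∧
      ∀ x, ev D x ≠ 0 → ∀ t : ℝ, ev P (x + t • e) = 0 → dirDeriv e (ev P) (x + t • e) ≠ 0 := by
  have hsep : (map (algebraMap _ (FractionRing (MvPolynomial (Fin n) ℝ)))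
      (shiftHom e P)).Separable := PerfectField.separable_iff_squarefree.2
    (squarefree_map_of_squarefree (squarefree_shiftHom h e))
  rw [separable_def, derivative_map] at hsep
  obtain ⟨a, b, D, hD, hab⟩ := exists_bezout_of_isCoprime_map hsep
  refine ⟨D, hD, fun x hx t h1 h2 => hx ?_⟩
  have h3 : ((derivative (shiftHom e P)).map (MvPolynomial.eval fun i => x i)).eval t = 0 := by
    rw [← derivative_map, ← h2]
    refine HasDerivAt.unique (Polynomial.hasDerivAt _ t) ?_
    simp_rw [eval_map_shiftHom]
    exact hasDerivAt_comp_line (differentiable_ev P) x e t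
  have := congrArg (fun p => (p.map (MvPolynomial.eval fun i => x i)).eval t) hab
  simp only [Polynomial.map_add, Polynomial.map_mul, eval_add, eval_mul, eval_map_shiftHom, h1, h3,
    map_C, eval_C, mul_zero, add_zero] at this
  exact this.symm

end Lines

/-! ### Factors of harmonic polynomials -/

theorem eq_zero_of_ev_eq_zero_of_isOpen {p : MvPolynomial (Fin n) ℝ} {s : Set (Euc n)}
    (hs : IsOpen s) (hne : s.Nonempty) (h : ∀ x ∈ s, ev p x = 0) : p = 0 := by
  obtain ⟨y, hy⟩ := hne
  have hpre : (fun z : Fin n → ℝ => (WithLp.toLp 2 z : Euc n)) ⁻¹' s ∈ 𝓝 (fun i => y i) :=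
    (PiLp.continuous_toLp 2 _).continuousAt.preimage_mem_nhds (hs.mem_nhds hy)
  obtain ⟨ε, hε, hball⟩ := Metric.mem_nhds_iff.1 hpre
  refine MvPolynomial.funext_set (fun i => Metric.ball (y i) ε) (fun i => ?_) fun z hz => ?_
  · rw [Real.ball_eq_Ioo]
    exact Ioo_infinite (by linarith)
  · rw [map_zero]
    refine h _ (hball ?_)
    rwa [ball_pi _ hε]

theorem exists_ev_ne_zero_of_isOpen {p : MvPolynomial (Fin n) ℝ} (hp : p ≠ 0) {s : Set (Euc n)}
    (hs : IsOpen s) (hne : s.Nonempty) : ∃ x ∈ s, ev p x ≠ 0 := by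
  by_contra! h
  exact hp (eq_zero_of_ev_eq_zero_of_isOpen hs hne h)

theorem tendsto_ev_smul_div_pow (U : MvPolynomial (Fin n) ℝ) (x : Euc n) :
    Tendsto (fun r : ℝ => ev U (r • x) / r ^ U.totalDegree) atTop
      (𝓝 (ev (MvPolynomial.homogeneousComponent U.totalDegree U) x)) := by
  have h1 : ∀ r : ℝ, ev U (r • x) / r ^ U.totalDegree =
      ∑ j ∈ Finset.range (U.totalDegree + 1),
        ev (MvPolynomial.homogeneousComponent j U) x * (r ^ j / r ^ U.totalDegree) := fun r => by
    rw [ev_smul_eq_sum, Finset.sum_div]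
    exact Finset.sum_congr rfl fun j _ => by ring
  simp_rw [h1, Finset.sum_range_succ]
  rw [show 𝓝 (ev (MvPolynomial.homogeneousComponent U.totalDegree U) x) =
    𝓝 (∑ j ∈ Finset.range U.totalDegree, ev (MvPolynomial.homogeneousComponent j U) x * 0 +
      ev (MvPolynomial.homogeneousComponent U.totalDegree U) x * 1) by simp]
  refine (tendsto_finsetSum _ fun j hj => Tendsto.const_mul _
    (tendsto_pow_div_pow_atTop_zero (Finset.mem_range.1 hj))).add (Tendsto.const_mul _ ?_)
  refine tendsto_const_nhds.congr' ?_
  filter_upwards [eventually_gt_atTop 0] with r hr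
  rw [div_self (pow_pos hr _).ne']

theorem homogeneousComponent_totalDegree_mul {p q : MvPolynomial (Fin n) ℝ} (hp : p ≠ 0)
    (hq : q ≠ 0) : MvPolynomial.homogeneousComponent (p * q).totalDegree (p * q) =
      MvPolynomial.homogeneousComponent p.totalDegree p *
        MvPolynomial.homogeneousComponent q.totalDegree q := by
  refine ext_of_ev fun x => ?_
  refine tendsto_nhds_unique (tendsto_ev_smul_div_pow (p * q) x) ?_
  rw [ev_mul]
  refine ((tendsto_ev_smul_div_pow p x).mul (tendsto_ev_smul_div_pow q x)).congr fun r => ?_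
  rw [MvPolynomial.totalDegree_mul_of_isDomain hp hq, ev_mul, pow_add, mul_div_mul_comm]

/-- The top homogeneous component of a harmonic polynomial is orthogonal to polynomials of lower
degree. -/
theorem IsHarm.integral_homogeneousComponent_mul_eq_zero {U q : MvPolynomial (Fin n) ℝ}
    (hU : IsHarm (ev U)) (hq : q.totalDegree < U.totalDegree) :
    ∫ x, bump (‖x‖ ^ 2) *
      (ev (MvPolynomial.homogeneousComponent U.totalDegree U) x * ev q x) = 0 := by
  obtain ⟨p, hp, hpr, -⟩ := hU.exists_moment_polynomial_coeff q
  set I : ℕ → ℝ := fun j =>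
    ∫ x, bump (‖x‖ ^ 2) * (ev (MvPolynomial.homogeneousComponent j U) x * ev q x) with hI
  -- The moment is computed twice: it has degree at most `deg q` in `r`, yet its coefficient at `deg
  -- U` is the integral in question.
  have h1 : p = ∑ j ∈ Finset.range (U.totalDegree + 1),
      Polynomial.C (I j) * Polynomial.X ^ j := by
    refine Polynomial.funext fun r => ?_
    have hc : ∀ j, Continuous fun x : Euc n =>
        ev (MvPolynomial.homogeneousComponent j U) x * ev q x := fun j =>
      (continuous_ev _).mul (continuous_ev _)
    simp only [Polynomial.eval_finsetSum, Polynomial.eval_mul, Polynomial.eval_pow,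
      Polynomial.eval_X, Polynomial.eval_C, ← hpr, hI, ← integral_mul_const]
    rw [← integral_finsetSum _ fun j _ => (integrable_bump_mul (hc j)).mul_const _]
    refine integral_congr_ae (Eventually.of_forall fun x => ?_)
    simp only [ev_smul_eq_sum U, Finset.sum_mul, Finset.mul_sum]
    exact Finset.sum_congr rfl fun j _ => by ring
  have h2 : p.coeff U.totalDegree = I U.totalDegree := by
    rw [h1]
    simp [Polynomial.finsetSum_coeff, Polynomial.coeff_C_mul, Polynomial.coeff_X_pow]
  rw [← hI] at *
  change I U.totalDegree = 0
  rw [← h2]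
  exact Polynomial.coeff_eq_zero_of_natDegree_lt (hp.trans_lt hq)

/-- A nonnegative factor of a nonzero harmonic polynomial is constant. -/
theorem IsHarm.totalDegree_eq_zero_of_nonneg {h q : MvPolynomial (Fin n) ℝ}
    (hU : IsHarm (ev (h * q))) (h0 : h * q ≠ 0) (hnn : ∀ x, 0 ≤ ev h x) : h.totalDegree = 0 := by
  have hh : h ≠ 0 := left_ne_zero_of_mul h0
  have hq : q ≠ 0 := right_ne_zero_of_mul h0
  by_contra hdeg
  have hd := MvPolynomial.totalDegree_mul_of_isDomain hh hq
  set h' := MvPolynomial.homogeneousComponent h.totalDegree h with hh'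
  set q' := MvPolynomial.homogeneousComponent q.totalDegree q with hq'
  have hh0 : h' ≠ 0 := homogeneousComponent_totalDegree_ne_zero hh
  have hq0 : q' ≠ 0 := homogeneousComponent_totalDegree_ne_zero hq
  have hnn' : ∀ x, 0 ≤ ev h' x := fun x => by
    refine ge_of_tendsto (tendsto_ev_smul_div_pow h x) ?_
    filter_upwards [eventually_ge_atTop 0] with r hr
    exact div_nonneg (hnn _) (pow_nonneg hr _)
  -- If `deg h > 0`, the top form `h' q'` of the harmonic polynomial is orthogonal to `q'`; but `h'
  -- q'²` is nonnegative, so it would vanish identically.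
  have h1 := hU.integral_homogeneousComponent_mul_eq_zero (q := q')
    (((MvPolynomial.homogeneousComponent_isHomogeneous _ q).totalDegree_le).trans_lt (by omega))
  rw [homogeneousComponent_totalDegree_mul hh hq, ← hh', ← hq'] at h1
  refine mul_ne_zero (mul_ne_zero hh0 hq0) hq0 (eq_zero_of_ev_eq_zero_of_isOpen
    (s := Metric.ball (0 : Euc n) 1) Metric.isOpen_ball ⟨0, by simp⟩ fun x hx => ?_)
  rw [ev_mul]
  refine eq_zero_of_integral_bump_mul_eq_zero
    (F := fun x => ev (h' * q') x * ev q' x) ((continuous_ev _).mul (continuous_ev _))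
    (fun x _ => ?_) h1 (by simpa using hx)
  rw [ev_mul, mul_assoc]
  exact mul_nonneg (hnn' x) (mul_self_nonneg _)

theorem isUnit_of_totalDegree_eq_zero {p : MvPolynomial (Fin n) ℝ} (hp : p ≠ 0)
    (h : p.totalDegree = 0) : IsUnit p := by
  rw [MvPolynomial.totalDegree_eq_zero_iff_eq_C] at h
  rw [h] at hp ⊢
  exact (IsUnit.mk0 _ fun h0 => hp (by rw [h0, map_zero])).map MvPolynomial.C

/-- A repeated factor `p` would give the nonnegative factor `p²`, which must be constant. -/
theorem IsHarm.squarefree {U : MvPolynomial (Fin n) ℝ} (hU : IsHarm (ev U)) (h0 : U ≠ 0) :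
    Squarefree U := by
  rintro p ⟨q, rfl⟩
  have hp : p * p ≠ 0 := left_ne_zero_of_mul h0
  have h1 := hU.totalDegree_eq_zero_of_nonneg h0 fun x => by
    rw [ev_mul]
    exact mul_self_nonneg _
  exact isUnit_of_mul_isUnit_left (isUnit_of_totalDegree_eq_zero hp h1)

/-- A non-constant factor of a nonzero harmonic polynomial changes sign. -/
theorem IsHarm.exists_neg_pos_of_mul {h q : MvPolynomial (Fin n) ℝ}
    (hU : IsHarm (ev (h * q))) (h0 : h * q ≠ 0) (hu : ¬ IsUnit h) :
    (∃ x, ev h x < 0) ∧ ∃ x, 0 < ev h x := by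
  have hh : h ≠ 0 := left_ne_zero_of_mul h0
  constructor
  · by_contra! hc
    exact hu (isUnit_of_totalDegree_eq_zero hh (hU.totalDegree_eq_zero_of_nonneg h0 hc))
  · by_contra! hc
    have h1 : h * q = -h * -q := by ring
    rw [h1] at hU h0
    have := hU.totalDegree_eq_zero_of_nonneg h0 fun x => by
      rw [ev_neg]
      exact neg_nonneg.2 (hc x)
    rw [MvPolynomial.totalDegree_neg] at this
    exact hu (isUnit_of_totalDegree_eq_zero hh this)

/-- A polynomial vanishing on the zero set of a harmonic polynomial is divisible by it. -/
theorem IsHarm.dvd_of_forall_ev_eq_zero {U V : MvPolynomial (Fin n) ℝ} (hU : IsHarm (ev U))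
    (h0 : U ≠ 0) (hZ : ∀ x, ev U x = 0 → ev V x = 0) : U ∣ V := by
  let : StrongNormalizationMonoid (MvPolynomial (Fin n) ℝ) :=
    UniqueFactorizationMonoid.strongNormalizationMonoid
  let : NormalizedGCDMonoid (MvPolynomial (Fin n) ℝ) :=
    UniqueFactorizationMonoid.toNormalizedGCDMonoid _
  -- Write `U = g h` with `g` the gcd; squarefreeness makes `h` coprime to `V`. A nonconstant `h`
  -- changes sign, so it vanishes somewhere on a generic line, at a point where `U = 0` but `V ≠ 0`.
  obtain ⟨h, k, hUh, hVk, hunit⟩ := extract_gcd U V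
  set g := gcd U V with hg
  have hsq := hU.squarefree h0
  have hrel : IsRelPrime h V := by
    rw [hVk]
    refine IsRelPrime.mul_right ?_ (gcd_isUnit_iff_isRelPrime.1 hunit)
    rw [hUh] at hsq
    exact (squarefree_mul_iff.1 hsq).1.symm
  by_cases hh : IsUnit h
  · rw [hUh, hVk]
    exact mul_dvd_mul_left _ (hh.dvd)
  exfalso
  have hUh' : U = h * g := by rw [mul_comm, ← hUh]
  have hhg : h * g ≠ 0 := hUh' ▸ h0
  rw [hUh'] at hU hZ
  obtain ⟨⟨a, ha⟩, ⟨b, hb⟩⟩ := hU.exists_neg_pos_of_mul hhg hh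
  obtain ⟨D, hD, hline⟩ := exists_forall_line_not_common_zero (left_ne_zero_of_mul hhg) hrel (b - a)
  -- The sign conditions at the two ends are open, so the line can be translated off the exceptional
  -- set `D = 0`.
  have hopen : IsOpen {x : Euc n | ev h x < 0 ∧ 0 < ev h (x + (b - a))} :=
    (isOpen_lt (continuous_ev h) continuous_const).inter
      (isOpen_lt continuous_const ((continuous_ev h).comp (by fun_prop)))
  obtain ⟨x, ⟨hx1, hx2⟩, hxD⟩ := exists_ev_ne_zero_of_isOpen hD hopen ⟨a, ha, by simpa using hb⟩
  have hcont : ContinuousOn (fun t : ℝ => ev h (x + t • (b - a))) (Icc 0 1) :=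
    ((continuous_ev h).comp (by fun_prop)).continuousOn
  obtain ⟨t, -, ht⟩ := intermediate_value_Icc zero_le_one hcont
    (show (0 : ℝ) ∈ Icc _ _ from ⟨by simpa using hx1.le, by simpa using hx2.le⟩)
  refine hline x hxD t ht (hZ _ ?_)
  rw [ev_mul]
  exact mul_eq_zero_of_left ht _

/-! ### The sign of the product of functions with the same zero set -/

theorem pos_of_isPreconnected {v : Euc n → ℝ} (hv : Continuous v) {s : Set (Euc n)}
    (hs : IsPreconnected s) (hne : ∀ x ∈ s, v x ≠ 0) {x y : Euc n} (hx : x ∈ s) (hy : y ∈ s)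
    (h : 0 < v x) : 0 < v y := by
  by_contra! hle
  obtain ⟨z, hz, hz0⟩ := hs.intermediate_value hy hx hv.continuousOn ⟨hle, h.le⟩
  exact hne z hz hz0

/-- Near a zero `z` of `u` at which the derivative in direction `e` is positive, a function with
the same zero set has constant sign on `{u > 0}`. -/
theorem pos_transfer {u v : Euc n → ℝ} (hu : Differentiable ℝ u) (hv : Continuous v)
    (hZ : ∀ x, u x = 0 ↔ v x = 0) {z e : Euc n} {δ₀ δ τ : ℝ} (hτ : 0 < τ)
    (hδ : δ + τ * ‖e‖ ≤ δ₀) (hder : ∀ x ∈ Metric.ball z δ₀, 0 < dirDeriv e u x)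
    (hpos : ∀ x ∈ Metric.ball (z + τ • e) δ, 0 < u x)
    (hvp : 0 < v (z + τ • e)) {x : Euc n} (hx : x ∈ Metric.ball z δ) (hux : 0 < u x) : 0 < v x := by
  have hδ0 : 0 < δ := dist_nonneg.trans_lt (Metric.mem_ball.1 hx)
  -- Push `x` along `e` into a ball free of zeros, where the sign of `v` is known, and return: `u`
  -- increases along the segment, so no zero of `v` is met.
  have hend : x + τ • e ∈ Metric.ball (z + τ • e) δ := by
    rw [Metric.mem_ball, dist_add_right]
    exact hx
  have h1 : 0 < v (x + τ • e) := by
    refine pos_of_isPreconnected hv (convex_ball (z + τ • e) δ).isPreconnected (fun y hy => ?_)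
      (Metric.mem_ball_self hδ0) hend hvp
    rw [Ne, ← hZ]
    exact (hpos y hy).ne'
  have hmono : StrictMonoOn (fun t : ℝ => u (x + t • e)) (Icc 0 τ) := by
    refine strictMonoOn_of_deriv_pos (convex_Icc 0 τ)
      (hu.continuous.comp (by fun_prop)).continuousOn fun t ht => ?_
    rw [(hasDerivAt_comp_line hu x e t).deriv]
    rw [interior_Icc] at ht
    refine hder _ ?_
    rw [mem_ball_iff_norm, add_sub_right_comm]
    refine (norm_add_le _ _).trans_lt (lt_of_lt_of_le ?_ hδ)
    rw [norm_smul, Real.norm_of_nonneg ht.1.le]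
    have := mem_ball_iff_norm.1 hx
    nlinarith [norm_nonneg e, ht.2]
  have himg : IsPreconnected ((fun t : ℝ => x + t • e) '' Icc 0 τ) :=
    isPreconnected_Icc.image _ (by fun_prop : Continuous fun t : ℝ => x + t • e).continuousOn
  refine pos_of_isPreconnected hv himg ?_ ⟨τ, right_mem_Icc.2 hτ.le, rfl⟩
    ⟨0, left_mem_Icc.2 hτ.le, by simp⟩ h1
  rintro _ ⟨t, ht, rfl⟩
  rw [Ne, ← hZ]
  have h2 := hmono.monotoneOn (left_mem_Icc.2 hτ.le) ht ht.1
  simp only [zero_smul, add_zero] at h2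
  exact (hux.trans_le h2).ne'

/-- At a simple zero of `u` along a line, the product of `u` with a harmonic function with the same
zero set does not change sign along that line. -/
theorem IsHarm.eventually_sign_of_pos {u v : Euc n → ℝ} (hu : ContDiff ℝ 1 u) (hv : IsHarm v)
    (hZ : ∀ x, u x = 0 ↔ v x = 0) {z e : Euc n} (hz : u z = 0) (hpos : 0 < dirDeriv e u z) :
    (∀ᶠ s : ℝ in 𝓝[≠] 0, 0 < u (z + s • e) * v (z + s • e)) ∨
      ∀ᶠ s : ℝ in 𝓝[≠] 0, u (z + s • e) * v (z + s • e) < 0 := by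
  have hud : Differentiable ℝ u := hu.differentiable one_ne_zero
  have hvc : Continuous v := hv.contDiff.continuous
  obtain ⟨δ₀, hδ₀, hder⟩ := Metric.eventually_nhds_iff_ball.1
    ((continuous_dirDeriv hu e).continuousAt.eventually (lt_mem_nhds hpos))
  set τ := δ₀ / (2 * (‖e‖ + 1)) with hτdef
  have he1 : 0 < ‖e‖ + 1 := by positivity
  have hτ : 0 < τ := by positivity
  have hτe : τ * ‖e‖ ≤ δ₀ / 2 := by
    rw [hτdef, div_mul_eq_mul_div, div_le_div_iff₀ (by positivity) two_pos]
    nlinarith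
  have hmem : ∀ s : ℝ, |s| ≤ τ → z + s • e ∈ Metric.ball z δ₀ := fun s hs => by
    rw [mem_ball_iff_norm, add_sub_cancel_left, norm_smul, Real.norm_eq_abs]
    nlinarith [norm_nonneg e]
  have hmono : StrictMonoOn (fun t : ℝ => u (z + t • e)) (Icc (-τ) τ) := by
    refine strictMonoOn_of_deriv_pos (convex_Icc _ _)
      (hud.continuous.comp (by fun_prop)).continuousOn fun t ht => ?_
    rw [(hasDerivAt_comp_line hud z e t).deriv]
    rw [interior_Icc] at ht
    exact hder _ (hmem t (abs_le.2 ⟨ht.1.le, ht.2.le⟩))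
  have hup : ∀ s : ℝ, 0 < s → s ≤ τ → 0 < u (z + s • e) := fun s h1 h2 => by
    have := hmono (show (0 : ℝ) ∈ Icc (-τ) τ from ⟨by linarith, hτ.le⟩)
      (show s ∈ Icc (-τ) τ from ⟨by linarith, h2⟩) h1
    simpa [hz] using this
  have hun : ∀ s : ℝ, s < 0 → -τ ≤ s → u (z + s • e) < 0 := fun s h1 h2 => by
    have := hmono (show s ∈ Icc (-τ) τ from ⟨h2, by linarith⟩)
      (show (0 : ℝ) ∈ Icc (-τ) τ from ⟨by linarith, hτ.le⟩) h1
    simpa [hz] using this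
  obtain ⟨δ₁, hδ₁, hp⟩ := Metric.eventually_nhds_iff_ball.1
    (hud.continuous.continuousAt.eventually (lt_mem_nhds (hup τ hτ le_rfl)))
  obtain ⟨δ₂, hδ₂, hn⟩ := Metric.eventually_nhds_iff_ball.1
    (hud.continuous.continuousAt.eventually (gt_mem_nhds (hun (-τ) (by linarith) le_rfl)))
  set δ := min (δ₀ / 2) (min δ₁ δ₂) with hδdef
  have hδ : 0 < δ := lt_min (by positivity) (lt_min hδ₁ hδ₂)
  have hδτ : δ + τ * ‖e‖ ≤ δ₀ := by linarith [min_le_left (δ₀ / 2) (min δ₁ δ₂)]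
  have hb₁ : Metric.ball (z + τ • e) δ ⊆ Metric.ball (z + τ • e) δ₁ :=
    Metric.ball_subset_ball ((min_le_right _ _).trans (min_le_left _ _))
  have hb₂ : Metric.ball (z + (-τ) • e) δ ⊆ Metric.ball (z + (-τ) • e) δ₂ :=
    Metric.ball_subset_ball ((min_le_right _ _).trans (min_le_right _ _))
  have hupper : ∀ w : Euc n → ℝ, Continuous w → (∀ x, u x = 0 ↔ w x = 0) →
      0 < w (z + τ • e) → ∀ x ∈ Metric.ball z δ, 0 < u x → 0 < w x := fun w hw hwZ hwp x hx hux =>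
    pos_transfer hud hw hwZ hτ hδτ hder (fun y hy => hp y (hb₁ hy)) hwp hx hux
  have hlower : ∀ w : Euc n → ℝ, Continuous w → (∀ x, u x = 0 ↔ w x = 0) →
      0 < w (z + (-τ) • e) → ∀ x ∈ Metric.ball z δ, u x < 0 → 0 < w x := by
    intro w hw hwZ hwp x hx hux
    -- The side `u < 0` is reduced to the other one by passing to `-u` and `-e`.
    have hneg : ∀ x, dirDeriv (-e) (fun x => -u x) x = dirDeriv e u x := fun x => by
      simp [dirDeriv, fderiv_fun_neg]
    refine pos_transfer (u := fun x => -u x) (e := -e) (δ₀ := δ₀) hud.neg hw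
      (fun x => by simp [hwZ]) hτ
      (by rwa [norm_neg]) (fun y hy => by rw [hneg]; exact hder y hy) (fun y hy => ?_) ?_ hx
      (neg_pos.2 hux)
    · rw [smul_neg, ← neg_smul] at hy
      exact neg_pos.2 (hn y (hb₂ hy))
    · rwa [smul_neg, ← neg_smul]
  have hsmall : ∀ᶠ s : ℝ in 𝓝[≠] 0, z + s • e ∈ Metric.ball z δ ∧ |s| ≤ τ ∧ s ≠ 0 := by
    have h1 : Tendsto (fun s : ℝ => z + s • e) (𝓝 0) (𝓝 z) := by
      have : Continuous fun s : ℝ => z + s • e := by fun_prop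
      simpa using this.tendsto 0
    have h2 : ∀ᶠ s : ℝ in 𝓝 0, |s| < τ := by
      have := (continuous_abs (G := ℝ)).tendsto 0
      rw [abs_zero] at this
      exact this.eventually (gt_mem_nhds hτ)
    filter_upwards [nhdsWithin_le_nhds (h1.eventually (Metric.ball_mem_nhds z hδ)),
      nhdsWithin_le_nhds h2, self_mem_nhdsWithin] with s h3 h4 h5
    exact ⟨h3, h4.le, h5⟩
  -- If `w` were positive on both sides, `z` would be a local minimum with value 0; the strong
  -- minimum principle makes `w`, hence `u`, vanish near `z`, against the monotonicity of `u` along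
  -- `e`.
  have hnosame : ∀ w : Euc n → ℝ, IsHarm w → (∀ x, u x = 0 ↔ w x = 0) →
      0 < w (z + τ • e) → 0 < w (z + (-τ) • e) → False := by
    intro w hw hwZ h1 h2
    have hwz : w z = 0 := (hwZ z).1 hz
    have hge : ∀ x ∈ Metric.ball z δ, w z ≤ w x := fun x hx => by
      rw [hwz]
      rcases lt_trichotomy (u x) 0 with h | h | h
      · exact (hlower w hw.contDiff.continuous hwZ h2 x hx h).le
      · exact ((hwZ x).1 h).ge
      · exact (hupper w hw.contDiff.continuous hwZ h1 x hx h).le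
    obtain ⟨s, hs1, hs2, hs3⟩ := hsmall.exists
    have h3 : u (z + s • e) = 0 := by
      rw [hwZ, hw.eq_of_forall_le hδ hge _ hs1, hwz]
    rcases lt_or_gt_of_ne hs3 with h | h
    · exact (hun s h (abs_le.1 hs2).1).ne h3
    · exact (hup s h (abs_le.1 hs2).2).ne' h3
  have hvneg : ∀ x, u x = 0 ↔ -v x = 0 := fun x => by rw [neg_eq_zero, hZ]
  have hne₁ : v (z + τ • e) ≠ 0 := by
    rw [Ne, ← hZ]
    exact (hup τ hτ le_rfl).ne'
  have hne₂ : v (z + (-τ) • e) ≠ 0 := by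
    rw [Ne, ← hZ]
    exact (hun (-τ) (by linarith) le_rfl).ne
  rcases lt_or_gt_of_ne hne₁ with h1 | h1 <;> rcases lt_or_gt_of_ne hne₂ with h2 | h2
  · exact (hnosame _ hv.neg hvneg (neg_pos.2 h1) (neg_pos.2 h2)).elim
  · right
    filter_upwards [hsmall] with s hs
    obtain ⟨hs1, hs2, hs3⟩ := hs
    rcases lt_or_gt_of_ne hs3 with h | h
    · have hu' := hun s h (abs_le.1 hs2).1
      exact mul_neg_of_neg_of_pos hu' (hlower v hvc hZ h2 _ hs1 hu')
    · have hu' := hup s h (abs_le.1 hs2).2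
      exact mul_neg_of_pos_of_neg hu'
        (neg_pos.1 (hupper _ hvc.neg hvneg (neg_pos.2 h1) _ hs1 hu'))
  · left
    filter_upwards [hsmall] with s hs
    obtain ⟨hs1, hs2, hs3⟩ := hs
    rcases lt_or_gt_of_ne hs3 with h | h
    · have hu' := hun s h (abs_le.1 hs2).1
      exact mul_pos_of_neg_of_neg hu'
        (neg_pos.1 (hlower _ hvc.neg hvneg (neg_pos.2 h2) _ hs1 hu'))
    · have hu' := hup s h (abs_le.1 hs2).2
      exact mul_pos hu' (hupper v hvc hZ h1 _ hs1 hu')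
  · exact (hnosame v hv hZ h1 h2).elim

theorem IsHarm.eventually_sign {u v : Euc n → ℝ} (hu : ContDiff ℝ 1 u) (hv : IsHarm v)
    (hZ : ∀ x, u x = 0 ↔ v x = 0) {x e : Euc n} {t : ℝ}
    (ht : u (x + t • e) = 0 → dirDeriv e u (x + t • e) ≠ 0) :
    (∀ᶠ s : ℝ in 𝓝[≠] t, 0 < u (x + s • e) * v (x + s • e)) ∨
      ∀ᶠ s : ℝ in 𝓝[≠] t, u (x + s • e) * v (x + s • e) < 0 := by
  have hcont : Continuous fun s : ℝ => u (x + s • e) * v (x + s • e) :=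
    (hu.continuous.comp (by fun_prop)).mul (hv.contDiff.continuous.comp (by fun_prop))
  by_cases hz : u (x + t • e) = 0
  · have htrans : Tendsto (fun s : ℝ => s - t) (𝓝[≠] t) (𝓝[≠] 0) := by
      refine tendsto_nhdsWithin_iff.2 ⟨?_, ?_⟩
      · have : Continuous fun s : ℝ => s - t := by fun_prop
        simpa using (this.tendsto t).mono_left nhdsWithin_le_nhds
      · filter_upwards [self_mem_nhdsWithin] with s hs
        exact sub_ne_zero.2 hs
    have heq : ∀ s : ℝ, x + t • e + (s - t) • e = x + s • e := fun s => by
      rw [add_assoc, ← add_smul, add_sub_cancel]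
    rcases lt_or_gt_of_ne (ht hz) with h | h
    · have hneg : dirDeriv e (fun x => -u x) (x + t • e) = -dirDeriv e u (x + t • e) := by
        simp [dirDeriv, fderiv_fun_neg]
      rcases IsHarm.eventually_sign_of_pos (u := fun x => -u x) hu.neg hv
        (fun y => by rw [neg_eq_zero, hZ]) (by rw [hz, neg_zero])
        (hneg ▸ neg_pos.2 h) with h1 | h1
      · right
        filter_upwards [htrans.eventually h1] with s hs
        rw [heq] at hs
        linarith
      · left
        filter_upwards [htrans.eventually h1] with s hs
        rw [heq] at hs
        linarith
    · rcases IsHarm.eventually_sign_of_pos hu hv hZ hz h with h1 | h1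
      · left
        filter_upwards [htrans.eventually h1] with s hs
        rwa [heq] at hs
      · right
        filter_upwards [htrans.eventually h1] with s hs
        rwa [heq] at hs
  · have hne : u (x + t • e) * v (x + t • e) ≠ 0 := mul_ne_zero hz (by rwa [Ne, ← hZ])
    rcases lt_or_gt_of_ne hne with h | h
    · exact Or.inr (nhdsWithin_le_nhds (hcont.continuousAt.eventually (gt_mem_nhds h)))
    · exact Or.inl (nhdsWithin_le_nhds (hcont.continuousAt.eventually (lt_mem_nhds h)))

/-- A continuous function on `ℝ` with a sign on each punctured neighbourhood has a global sign. -/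
theorem not_pos_and_neg_of_eventually_sign {f : ℝ → ℝ} (hf : Continuous f)
    (h : ∀ t, (∀ᶠ s in 𝓝[≠] t, 0 < f s) ∨ ∀ᶠ s in 𝓝[≠] t, f s < 0) {a b : ℝ} (ha : 0 < f a)
    (hb : f b < 0) : False := by
  -- The sets where the punctured sign is positive or negative are open and cover the line; by
  -- connectedness they would meet.
  have hopen : ∀ g : ℝ → ℝ, Continuous g → IsOpen {t | ∀ᶠ s in 𝓝[≠] t, 0 < g s} := by
    intro g hg
    rw [isOpen_iff_eventually]
    intro t ht
    rw [mem_ofPred_eq, eventually_nhdsWithin_iff] at ht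
    filter_upwards [ht] with s hs
    by_cases hst : s = t
    · subst hst
      exact eventually_nhdsWithin_iff.2 ht
    · exact nhdsWithin_le_nhds (hg.continuousAt.eventually (lt_mem_nhds (hs hst)))
  have h1 := hopen f hf
  have h2 := hopen (fun s => -f s) hf.neg
  simp only [neg_pos] at h2
  obtain ⟨t, -, ht1, ht2⟩ := isPreconnected_univ _ _ h1 h2 (fun t _ => h t)
    ⟨a, mem_univ a, nhdsWithin_le_nhds (hf.continuousAt.eventually (lt_mem_nhds ha))⟩
    ⟨b, mem_univ b, nhdsWithin_le_nhds (hf.continuousAt.eventually (gt_mem_nhds hb))⟩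
  rw [mem_ofPred_eq] at ht1 ht2
  obtain ⟨s, hs1, hs2⟩ := (ht1.and ht2).exists
  exact lt_asymm hs1 hs2

/-- The product of a harmonic polynomial and a harmonic function with the same zero set has
constant sign. -/
theorem IsHarm.mul_nonneg_or_nonpos {U : MvPolynomial (Fin n) ℝ} (hU : IsHarm (ev U)) (h0 : U ≠ 0)
    {v : Euc n → ℝ} (hv : IsHarm v) (hZ : ∀ x, ev U x = 0 ↔ v x = 0) :
    (∀ x, 0 ≤ ev U x * v x) ∨ ∀ x, ev U x * v x ≤ 0 := by
  by_contra! hcon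
  obtain ⟨⟨b, hb⟩, ⟨a, ha⟩⟩ := hcon
  -- Join points of opposite sign by a line, translated slightly so that `U` has only simple zeros
  -- on it.
  obtain ⟨D, hD, hline⟩ := exists_forall_line_simple_zero (hU.squarefree h0) (b - a)
  have hc : Continuous fun x => ev U x * v x := (continuous_ev U).mul hv.contDiff.continuous
  have hopen : IsOpen {x : Euc n | 0 < ev U x * v x ∧
      ev U (x + (b - a)) * v (x + (b - a)) < 0} :=
    (isOpen_lt continuous_const hc).inter
      (isOpen_lt (hc.comp (by fun_prop : Continuous fun x => x + (b - a))) continuous_const)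
  obtain ⟨x, ⟨hx1, hx2⟩, hxD⟩ := exists_ev_ne_zero_of_isOpen hD hopen ⟨a, ha, by simpa using hb⟩
  refine not_pos_and_neg_of_eventually_sign
    (f := fun t : ℝ => ev U (x + t • (b - a)) * v (x + t • (b - a)))
    (hc.comp (by fun_prop : Continuous fun t : ℝ => x + t • (b - a)))
    (fun t => hv.eventually_sign (contDiff_ev U) hZ (hline x hxD t)) (a := 0) (b := 1) ?_ ?_
  · simpa using hx1
  · simpa using hx2

/-! ### The Liouville property -/

theorem exists_eval_bound {P : Polynomial ℝ} {N : ℕ} (hP : P.natDegree ≤ N) :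
    ∃ B, 0 ≤ B ∧ ∀ r : ℝ, 1 ≤ r → |P.eval r| ≤ B * r ^ N := by
  refine ⟨∑ j ∈ Finset.range (N + 1), |P.coeff j|, Finset.sum_nonneg fun _ _ => abs_nonneg _,
    fun r hr => ?_⟩
  have hr0 : 0 ≤ r := by linarith
  rw [Polynomial.eval_eq_sum_range' (Nat.lt_succ_iff.2 hP), Finset.sum_mul]
  refine (Finset.abs_sum_le_sum_abs _ _).trans (Finset.sum_le_sum fun j hj => ?_)
  rw [abs_mul, abs_of_nonneg (pow_nonneg hr0 j)]
  exact mul_le_mul_of_nonneg_left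
    (pow_le_pow_right₀ hr (Nat.lt_succ_iff.1 (Finset.mem_range.1 hj))) (abs_nonneg _)

theorem exists_ev_smul_bound (U : MvPolynomial (Fin n) ℝ) :
    ∃ B, 0 ≤ B ∧ ∀ r : ℝ, 1 ≤ r → ∀ x, ‖x‖ ≤ 1 → |ev U (r • x)| ≤ B * r ^ U.totalDegree := by
  choose b hb0 hb using fun j => exists_ev_bound (MvPolynomial.homogeneousComponent j U)
  refine ⟨∑ j ∈ Finset.range (U.totalDegree + 1), b j, Finset.sum_nonneg fun j _ => hb0 j,
    fun r hr x hx => ?_⟩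
  have hr0 : 0 ≤ r := by linarith
  rw [ev_smul_eq_sum, Finset.sum_mul]
  refine (Finset.abs_sum_le_sum_abs _ _).trans (Finset.sum_le_sum fun j hj => ?_)
  rw [abs_mul, abs_of_nonneg (pow_nonneg hr0 j), mul_comm]
  exact mul_le_mul (hb j x hx)
    (pow_le_pow_right₀ hr (Nat.lt_succ_iff.1 (Finset.mem_range.1 hj))) (pow_nonneg hr0 j) (hb0 j)

/-- A harmonic function vanishing on the zero set of a harmonic polynomial `u`, and whose ratio to
`u` is bounded above by `C √r` in `B_r` for arbitrarily large `r`, is a multiple of `u`. -/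
theorem IsHarm.exists_eq_const_mul {U : MvPolynomial (Fin n) ℝ} (hU : IsHarm (ev U)) (h0 : U ≠ 0)
    {v : Euc n → ℝ} (hv : IsHarm v) (hZ : ∀ x, ev U x = 0 → v x = 0) {C : ℝ} (hC : 0 ≤ C)
    (h : ∃ᶠ r : ℝ in atTop, ∀ x, ‖x‖ < r → ev U x ≠ 0 → v x / ev U x ≤ C * √r) :
    ∃ c : ℝ, ∀ x, v x = c * ev U x := by
  obtain ⟨P, hPd, hPr, -⟩ := hv.exists_product_moment_polynomial U 1
  rw [MvPolynomial.totalDegree_one, add_zero] at hPd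
  obtain ⟨B₁, hB₁, hb₁⟩ := exists_eval_bound hPd
  obtain ⟨B₂, hB₂, hb₂⟩ := exists_ev_smul_bound U
  set I := ∫ x : Euc n, bump (‖x‖ ^ 2) with hI
  have hI0 : 0 < I := integral_bump_pos
  -- A one-sided bound suffices: `|Uv| ≤ 2C√r U² - Uv`, and the weighted integral of `Uv` is the
  -- polynomial `P` of degree at most `2 deg U`, with no growth assumption on `v`.
  have hgrowth : ∃ᶠ r : ℝ in atTop, ∫ x, bump (‖x‖ ^ 2) * |ev U (r • x) * v (r • x)| ≤
      (2 * C * B₂ ^ 2 * I + B₁) * (r ^ (2 * U.totalDegree) * √r) := by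
    refine (h.and_eventually (eventually_ge_atTop 1)).mono fun r ⟨hr, hr1⟩ => ?_
    have hr0 : 0 < r := by linarith
    have hs1 : 1 ≤ √r := Real.one_le_sqrt.2 hr1
    have hcu : Continuous fun x : Euc n => ev U (r • x) := (continuous_ev U).comp (by fun_prop)
    have hcv : Continuous fun x : Euc n => v (r • x) :=
      hv.contDiff.continuous.comp (by fun_prop)
    have hcuv : Continuous fun x : Euc n => ev U (r • x) * v (r • x) := hcu.mul hcv
    have hP' : ∫ x, bump (‖x‖ ^ 2) * (ev U (r • x) * v (r • x)) = P.eval r := by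
      rw [← hPr r]
      simp
    have hle : ∫ x, bump (‖x‖ ^ 2) * |ev U (r • x) * v (r • x)| ≤
        ∫ x : Euc n, (bump (‖x‖ ^ 2) * (2 * C * √r * (B₂ * r ^ U.totalDegree) ^ 2) -
          bump (‖x‖ ^ 2) * (ev U (r • x) * v (r • x))) := by
      refine integral_mono (integrable_bump_mul hcuv.abs)
        ((integrable_bump_mul continuous_const).sub (integrable_bump_mul hcuv)) fun x => ?_
      simp only
      by_cases hx : ‖x‖ < 1
      · rw [← mul_sub]
        refine mul_le_mul_of_nonneg_left ?_ (bump_nonneg _)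
        have hrx : ‖r • x‖ < r := by
          rw [norm_smul, Real.norm_of_nonneg hr0.le]
          nlinarith
        have h1 : ev U (r • x) * v (r • x) ≤ C * √r * ev U (r • x) ^ 2 := by
          by_cases hu : ev U (r • x) = 0
          · simp [hu]
          · have h2 := mul_le_mul_of_nonneg_right (hr _ hrx hu) (sq_nonneg (ev U (r • x)))
            have h3 : v (r • x) / ev U (r • x) * ev U (r • x) ^ 2 =
                ev U (r • x) * v (r • x) := by
              field_simp
            linarith
        have h4 : ev U (r • x) ^ 2 ≤ (B₂ * r ^ U.totalDegree) ^ 2 := by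
          rw [← sq_abs]
          exact pow_le_pow_left₀ (abs_nonneg _) (hb₂ r hr1 x hx.le) 2
        have h5 : 0 ≤ C * √r := by positivity
        have h6 := mul_le_mul_of_nonneg_left h4 h5
        have h7 := mul_nonneg h5 (sq_nonneg (ev U (r • x)))
        rw [abs_le]
        constructor <;> nlinarith
      · simp [isProfile_bump.weight_eq_zero (not_lt.1 hx)]
    rw [integral_sub (integrable_bump_mul continuous_const) (integrable_bump_mul hcuv), hP',
      integral_mul_const, ← hI] at hle
    have h8 := (neg_le_abs _).trans (hb₁ r hr1)
    have h9 : B₁ * r ^ (2 * U.totalDegree) ≤ B₁ * (r ^ (2 * U.totalDegree) * √r) := by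
      refine mul_le_mul_of_nonneg_left ?_ hB₁
      exact le_mul_of_one_le_right (by positivity) hs1
    have h10 : I * (2 * C * √r * (B₂ * r ^ U.totalDegree) ^ 2) =
        2 * C * B₂ ^ 2 * I * (r ^ (2 * U.totalDegree) * √r) := by
      rw [mul_pow, ← pow_mul, mul_comm U.totalDegree]
      ring
    linarith
  -- With `M = 2 deg U` the conclusion is `deg V ≤ deg U`, so the quotient of `V` by `U` is
  -- constant.
  obtain ⟨V, hV, hVd⟩ := hv.exists_polynomial_of_growth h0 (by omega) hgrowth
  obtain ⟨W, rfl⟩ := hU.dvd_of_forall_ev_eq_zero h0 (V := V) fun x hx => by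
    rw [← hV, hZ x hx]
  by_cases hW : W = 0
  · exact ⟨0, fun x => by simp [hV, hW]⟩
  have hdeg : W.totalDegree = 0 := by
    rw [MvPolynomial.totalDegree_mul_of_isDomain h0 hW] at hVd
    omega
  rw [MvPolynomial.totalDegree_eq_zero_iff_eq_C] at hdeg
  refine ⟨W.coeff 0, fun x => ?_⟩
  rw [hV, ev_mul]
  conv_lhs => rw [hdeg]
  rw [ev_C, mul_comm]

/-- `Uv` has one sign; taking `-v` if needed, `v/U ≤ 0` and the Liouville property holds with `C =
0`. The constant is nonzero, since otherwise `Z(U) = Z(v)` would be the whole space. -/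
theorem IsHarm.exists_ne_zero_eq_const_mul {U : MvPolynomial (Fin n) ℝ} (hU : IsHarm (ev U))
    (h0 : U ≠ 0) {v : Euc n → ℝ} (hv : IsHarm v) (hZ : ∀ x, ev U x = 0 ↔ v x = 0) :
    ∃ c : ℝ, c ≠ 0 ∧ ∀ x, v x = c * ev U x := by
  have key : ∀ w : Euc n → ℝ, IsHarm w → (∀ x, ev U x = 0 ↔ w x = 0) →
      (∀ x, ev U x * w x ≤ 0) → ∃ c : ℝ, ∀ x, w x = c * ev U x := by
    intro w hw hwZ hle
    refine hU.exists_eq_const_mul h0 hw (fun x => (hwZ x).1) le_rfl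
      (Frequently.of_forall fun r x _ hx => ?_)
    have h1 : w x / ev U x = ev U x * w x / ev U x ^ 2 := by field_simp
    rw [zero_mul, h1]
    exact div_nonpos_of_nonpos_of_nonneg (hle x) (sq_nonneg _)
  have : ∃ c : ℝ, ∀ x, v x = c * ev U x := by
    rcases hU.mul_nonneg_or_nonpos h0 hv hZ with h | h
    · obtain ⟨c, hc⟩ := key _ hv.neg (fun x => by rw [neg_eq_zero, hZ]) fun x => by
        have := h x
        linarith
      exact ⟨-c, fun x => by linarith [hc x]⟩
    · exact key v hv hZ h
  obtain ⟨c, hc⟩ := this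
  refine ⟨c, ?_, hc⟩
  rintro rfl
  refine h0 (ext_of_ev fun x => ?_)
  rw [ev_zero, hZ, hc, zero_mul]

/-! ### Harmonic functions of bounded frequency are polynomials -/

/-- Among the minimum points of `v` in the closed ball take one of largest norm. If interior, it is
surrounded by a ball on which `v` is constant, and this ball contains points of larger norm. -/
theorem IsHarm.nonneg_of_sphere (hn : 0 < n) {v : Euc n → ℝ} (hv : IsHarm v) {r : ℝ} (hr : 0 < r)
    (h : ∀ x, ‖x‖ = r → 0 ≤ v x) {x : Euc n} (hx : ‖x‖ ≤ r) : 0 ≤ v x := by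
  have : Nonempty (Fin n) := ⟨⟨0, hn⟩⟩
  by_contra! hneg
  have hvc := hv.contDiff.continuous
  obtain ⟨y, hy, hmin⟩ := (isCompact_closedBall (0 : Euc n) r).exists_isMinOn
    ⟨x, by simpa using hx⟩ hvc.continuousOn
  have hm : v y < 0 := (hmin (show x ∈ Metric.closedBall 0 r by simpa using hx)).trans_lt hneg
  have hK : IsCompact (Metric.closedBall (0 : Euc n) r ∩ v ⁻¹' {v y}) :=
    (isCompact_closedBall _ _).inter_right (isClosed_singleton.preimage hvc)
  obtain ⟨z, ⟨hz, hzy⟩, hmax⟩ := hK.exists_isMaxOn ⟨y, hy, rfl⟩ continuous_norm.continuousOn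
  have hzy' : v z = v y := hzy
  rw [mem_closedBall_zero_iff] at hz
  have hzr : ‖z‖ < r := lt_of_le_of_ne hz fun hzr => by linarith [h z hzr]
  have hsub : ∀ w ∈ Metric.ball z (r - ‖z‖), ‖w‖ ≤ r := fun w hw => by
    have h1 := norm_add_le (w - z) z
    rw [sub_add_cancel] at h1
    linarith [mem_ball_iff_norm.1 hw]
  have hconst := hv.eq_of_forall_le (sub_pos.2 hzr) fun w hw => by
    rw [hzy']
    exact hmin (show w ∈ Metric.closedBall 0 r by simpa using hsub w hw)
  have hnorm : ∀ w ∈ Metric.ball z (r - ‖z‖), ‖w‖ ≤ ‖z‖ := fun w hw =>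
    hmax ⟨by simpa using hsub w hw, (hconst w hw).trans hzy'⟩
  obtain ⟨w, hw1, hw2⟩ : ∃ w : Euc n, ‖w‖ = 1 ∧ z = ‖z‖ • w := by
    by_cases hz0 : z = 0
    · obtain ⟨w, hw⟩ := exists_norm_eq (Euc n) zero_le_one
      exact ⟨w, hw, by simp [hz0]⟩
    · refine ⟨‖z‖⁻¹ • z, norm_smul_inv_norm hz0, ?_⟩
      rw [smul_smul, mul_inv_cancel₀ (norm_ne_zero_iff.2 hz0), one_smul]
  have h1 := hnorm (z + ((r - ‖z‖) / 2) • w) (by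
    rw [mem_ball_iff_norm, add_sub_cancel_left, norm_smul, hw1, Real.norm_of_nonneg (by linarith)]
    linarith)
  have h2 : z + ((r - ‖z‖) / 2) • w = (‖z‖ + (r - ‖z‖) / 2) • w := by
    rw [add_smul, ← hw2]
  rw [h2, norm_smul, hw1, Real.norm_of_nonneg (by linarith [norm_nonneg z])] at h1
  linarith

theorem IsHarm.eq_zero_of_eventually {v : Euc n → ℝ} (hv : IsHarm v) (h : ∀ᶠ x in 𝓝 0, v x = 0)
    (x : Euc n) : v x = 0 := by
  have h1 : ∀ k, ev (taylorComp v k) x = 0 := by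
    refine eq_zero_of_eventually_hasSum_pow ?_
    have h2 : Tendsto (fun r : ℝ => r • x) (𝓝 0) (𝓝 0) := by
      have : Continuous fun r : ℝ => r • x := by fun_prop
      simpa using this.tendsto 0
    filter_upwards [h2.eventually h] with r hr
    have := hv.hasSum_taylorComp (r • x)
    rw [hr] at this
    refine this.congr_fun fun k => ?_
    rw [ev_smul_of_isHomogeneous (isHomogeneous_taylorComp v k)]
  have h3 := hv.hasSum_taylorComp x
  simp only [h1] at h3
  exact h3.unique hasSum_zero

/-! ### Polar coordinates and radial integration by parts. -/

/-- Integration in polar coordinates. -/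
theorem integral_eq_integral_sphere (hn : 0 < n) {F : Euc n → ℝ} (hF : Integrable F) {R : ℝ}
    (hR : ∀ x, R ≤ ‖x‖ → F x = 0) :
    ∫ x, F x = ∫ s in Ioo 0 R, s ^ (n - 1) * ∫ θ : Metric.sphere (0 : Euc n) 1,
      F (s • (θ : Euc n)) ∂(volume : Measure (Euc n)).toSphere := by
  have : Nonempty (Fin n) := ⟨⟨0, hn⟩⟩
  set μ : Measure (Euc n) := volume with hμ
  have hdim : Module.finrank ℝ (Euc n) = n := by simp
  have hmp := μ.measurePreserving_homeomorphUnitSphereProd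
  have hme : MeasurableEmbedding (homeomorphUnitSphereProd (Euc n)) :=
    Homeomorph.measurableEmbedding _
  rw [hdim] at hmp
  set f : Metric.sphere (0 : Euc n) 1 × Ioi (0 : ℝ) → ℝ :=
    fun p => F (p.2.1 • (p.1 : Euc n)) with hf
  have hcomp : ∀ x : ({0}ᶜ : Set (Euc n)), f (homeomorphUnitSphereProd (Euc n) x) = F x := by
    intro x
    have hx : ‖x.1‖ ≠ 0 := norm_ne_zero_iff.2 x.2
    simp only [hf, homeomorphUnitSphereProd_apply_fst_coe, homeomorphUnitSphereProd_apply_snd_coe]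
    rw [smul_smul, mul_inv_cancel₀ hx, one_smul]
  have h1 : ∫ x, F x ∂μ = ∫ p, f p ∂(μ.toSphere.prod (.volumeIoiPow (n - 1))) := by
    rw [← hmp.integral_comp hme]
    simp_rw [hcomp]
    rw [integral_subtype_comap (measurableSet_singleton _).compl F,
      restrict_compl_singleton]
  have hint : Integrable f (μ.toSphere.prod (.volumeIoiPow (n - 1))) := by
    rw [← hmp.integrable_comp_emb hme]
    have : f ∘ homeomorphUnitSphereProd (Euc n) = F ∘ Subtype.val := funext hcomp
    rw [this]
    exact ((MeasurableEmbedding.subtype_coe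
      (measurableSet_singleton (0 : Euc n)).compl).integrableOn_range_iff_comap).1 hF.integrableOn
  rw [h1, integral_prod_symm f hint]
  simp only [Measure.volumeIoiPow, ENNReal.ofReal]
  rw [integral_withDensity_eq_integral_smul
    ((measurable_subtype_coe.pow_const _).real_toNNReal),
    integral_subtype_comap measurableSet_Ioi fun a => Real.toNNReal (a ^ (n - 1)) •
      ∫ θ : Metric.sphere (0 : Euc n) 1, F (a • (θ : Euc n)) ∂μ.toSphere,
    setIntegral_congr_fun measurableSet_Ioi fun x hx => by
      rw [NNReal.smul_def, Real.coe_toNNReal _ (pow_nonneg (le_of_lt hx) _), smul_eq_mul]]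
  refine setIntegral_eq_of_subset_of_forall_sdiff_eq_zero measurableSet_Ioi Ioo_subset_Ioi_self ?_
  intro s hs
  have hs0 : 0 < s := hs.1
  have hsR : R ≤ s := by
    by_contra! hlt
    exact hs.2 ⟨hs0, hlt⟩
  have : ∀ θ : Metric.sphere (0 : Euc n) 1, F (s • (θ : Euc n)) = 0 := fun θ => by
    refine hR _ ?_
    rw [norm_smul, Real.norm_of_nonneg hs0.le, norm_eq_of_mem_sphere θ, mul_one]
    exact hsR
  simp [this]

theorem continuous_integral_sphere {F : Euc n → ℝ} (hF : Continuous F) :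
    Continuous fun s : ℝ => ∫ θ : Metric.sphere (0 : Euc n) 1, F (s • (θ : Euc n))
      ∂(volume : Measure (Euc n)).toSphere := by
  have := continuous_parametric_integral_of_continuous (s := univ)
    (μ := (volume : Measure (Euc n)).toSphere)
    (f := fun (s : ℝ) (θ : Metric.sphere (0 : Euc n) 1) => F (s • (θ : Euc n)))
    (by unfold Function.uncurry; fun_prop) isCompact_univ
  simpa using this

theorem setIntegral_Ioo_eq_intervalIntegral {f : ℝ → ℝ} {r : ℝ} (hr : 0 ≤ r) :
    ∫ s in Ioo 0 r, f s = ∫ s in (0 : ℝ)..r, f s := by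
  rw [intervalIntegral.integral_of_le hr, integral_Ioc_eq_integral_Ioo]

theorem setIntegral_ball_eq (hn : 0 < n) {G : Euc n → ℝ} (hG : Continuous G) {r : ℝ} (hr : 0 < r) :
    ∫ x in Metric.ball 0 r, G x = ∫ s in (0 : ℝ)..r, s ^ (n - 1) *
      ∫ θ : Metric.sphere (0 : Euc n) 1, G (s • (θ : Euc n))
        ∂(volume : Measure (Euc n)).toSphere := by
  have hint : IntegrableOn G (Metric.ball (0 : Euc n) r) :=
    (hG.continuousOn.integrableOn_compact (isCompact_closedBall 0 r)).mono_set
      Metric.ball_subset_closedBall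
  rw [← integral_indicator Metric.isOpen_ball.measurableSet,
    integral_eq_integral_sphere hn (hint.integrable_indicator Metric.isOpen_ball.measurableSet)
      (R := r) (fun x hx => indicator_of_notMem (by simpa using hx) _),
    ← setIntegral_Ioo_eq_intervalIntegral hr.le]
  refine setIntegral_congr_fun measurableSet_Ioo fun s hs => ?_
  congr 2
  funext θ
  refine indicator_of_mem ?_ _
  rw [mem_ball_zero_iff, norm_smul, Real.norm_of_nonneg hs.1.le, norm_eq_of_mem_sphere θ, mul_one]
  exact hs.2

theorem IsProfile.integral_mul_eq (hn : 0 < n) {k : ℝ → ℝ} (hk : IsProfile k) {G : Euc n → ℝ}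
    (hG : Continuous G) :
    ∫ x, k (‖x‖ ^ 2) * G x = ∫ s in (0 : ℝ)..1, k (s ^ 2) * (s ^ (n - 1) *
      ∫ θ : Metric.sphere (0 : Euc n) 1, G (s • (θ : Euc n))
        ∂(volume : Measure (Euc n)).toSphere) := by
  rw [integral_eq_integral_sphere hn (hk.integrable_mul hG) (R := 1)
    (fun x hx => by rw [hk.weight_eq_zero hx, zero_mul]),
    ← setIntegral_Ioo_eq_intervalIntegral zero_le_one]
  refine setIntegral_congr_fun measurableSet_Ioo fun s hs => ?_
  have h1 : ∀ θ : Metric.sphere (0 : Euc n) 1, ‖s • (θ : Euc n)‖ = s := fun θ => by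
    rw [norm_smul, Real.norm_of_nonneg hs.1.le, norm_eq_of_mem_sphere θ, mul_one]
  simp only [h1, integral_const_mul]
  ring

/-- Comparison of weighted integrals, from a comparison of integrals over balls and spheres. -/
theorem integral_primitive_mul_le (hn : 0 < n) {G W : Euc n → ℝ} (hG : Continuous G)
    (hW : Continuous W) {N : ℝ}
    (h : ∀ r ∈ Ioo (0 : ℝ) 1, r * ∫ x in Metric.ball 0 r, G x ≤ N * (r ^ (n - 1) *
      ∫ θ : Metric.sphere (0 : Euc n) 1, W (r • (θ : Euc n))
        ∂(volume : Measure (Euc n)).toSphere)) :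
    -∫ x, profilePrimitive bump (‖x‖ ^ 2) * G x ≤ 2 * N * ∫ x, bump (‖x‖ ^ 2) * W x := by
  set g : ℝ → ℝ := fun s => s ^ (n - 1) * ∫ θ : Metric.sphere (0 : Euc n) 1, G (s • (θ : Euc n))
    ∂(volume : Measure (Euc n)).toSphere with hg
  set w : ℝ → ℝ := fun s => s ^ (n - 1) * ∫ θ : Metric.sphere (0 : Euc n) 1, W (s • (θ : Euc n))
    ∂(volume : Measure (Euc n)).toSphere with hw
  have hgc : Continuous g := (continuous_pow _).mul (continuous_integral_sphere hG)
  have hwc : Continuous w := (continuous_pow _).mul (continuous_integral_sphere hW)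
  set D : ℝ → ℝ := fun r => ∫ s in (0 : ℝ)..r, g s with hD
  have hDd : ∀ r, HasDerivAt D (g r) r := fun r =>
    intervalIntegral.integral_hasDerivAt_right (hgc.intervalIntegrable _ _)
      (hgc.stronglyMeasurableAtFilter _ _) hgc.continuousAt
  have hDc : Continuous D := continuous_iff_continuousAt.2 fun r => (hDd r).continuousAt
  have hηd : ∀ r : ℝ, HasDerivAt (fun r => profilePrimitive bump (r ^ 2))
      (bump (r ^ 2) * (2 * r)) r := fun r => by
    have h1 : HasDerivAt (fun r : ℝ => r ^ 2) (2 * r) r := by simpa using hasDerivAt_pow 2 r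
    exact (isProfile_bump.hasDerivAt_primitive (r ^ 2)).comp r h1
  have hbc : Continuous fun s : ℝ => bump (s ^ 2) := isProfile_bump.continuous.comp (by fun_prop)
  rw [isProfile_bump.primitive.integral_mul_eq hn hG, isProfile_bump.integral_mul_eq hn hW]
  -- By parts in the radius: the primitive weight at `r²` has derivative `2r bump(r²)`, so the
  -- integral of `G` becomes an average of `r` times its ball integrals, to which the hypothesis
  -- applies.
  have hparts := intervalIntegral.integral_mul_deriv_eq_deriv_mul (a := 0) (b := 1)
    (fun r _ => hηd r) (fun r _ => hDd r)
    ((hbc.mul (by fun_prop)).intervalIntegrable _ _) (hgc.intervalIntegrable _ _)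
  have hD0 : D 0 = 0 := by simp [hD]
  have h1 : profilePrimitive bump (1 ^ 2) = 0 := isProfile_bump.primitive.eq_zero _ (by norm_num)
  rw [hD0, h1, zero_mul, mul_zero, sub_zero, zero_sub] at hparts
  rw [hparts, neg_neg, ← intervalIntegral.integral_const_mul]
  refine intervalIntegral.integral_mono_on_of_le_Ioo zero_le_one
    (((hbc.mul (by fun_prop)).mul hDc).intervalIntegrable _ _)
    ((continuous_const.mul (hbc.mul hwc)).intervalIntegrable _ _) fun s hs => ?_
  have h2 := h s hs
  rw [setIntegral_ball_eq hn hG hs.1] at h2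
  have h3 := mul_le_mul_of_nonneg_left h2 (bump_nonneg (s ^ 2))
  change bump (s ^ 2) * (s * D s) ≤ bump (s ^ 2) * (N * w s) at h3
  linarith

/-! ### From the frequency bound to polynomial growth. -/

theorem lap_sq {u : Euc n → ℝ} (hu : IsHarm u) (x : Euc n) :
    lap (fun x => u x ^ 2) x = 2 * ∑ i, dirDeriv (basisVec i) u x ^ 2 := by
  have hud : Differentiable ℝ u := hu.contDiff.differentiable two_ne_zero
  have hDd : ∀ i : Fin n, Differentiable ℝ (dirDeriv (basisVec i) u) := fun i =>
    (hu.isHarm_dirDeriv _).contDiff.differentiable two_ne_zero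
  have h1 : ∀ i : Fin n, dirDeriv (basisVec i) (fun x => u x ^ 2) =
      fun x => 2 * (u x * dirDeriv (basisVec i) u x) := fun i => by
    funext y
    have := dirDeriv_mul hud hud (basisVec i) y
    simp only [← sq] at this
    rw [this]
    ring
  have h2 : ∀ i : Fin n, dirDeriv (basisVec i) (fun x => 2 * (u x * dirDeriv (basisVec i) u x)) x =
      2 * dirDeriv (basisVec i) u x ^ 2 +
        2 * u x * dirDeriv (basisVec i) (dirDeriv (basisVec i) u) x := fun i => by
    have h3 := dirDeriv_mul (differentiable_const 2) (hud.mul (hDd i)) (basisVec i) x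
    have h4 := dirDeriv_mul hud (hDd i) (basisVec i) x
    have h5 : dirDeriv (basisVec i) (fun _ : Euc n => (2 : ℝ)) x = 0 := by simp [dirDeriv]
    simp only [Pi.mul_apply] at h3
    rw [h3, h5]
    change _ + 2 * dirDeriv (basisVec i) (fun x => u x * dirDeriv (basisVec i) u x) x = _
    rw [h4]
    ring
  unfold lap
  simp only [h1, h2, Finset.sum_add_distrib, ← Finset.mul_sum]
  rw [show ∑ i, dirDeriv (basisVec i) (dirDeriv (basisVec i) u) x = 0 from hu.lap_eq_zero x]
  ring

theorem norm_gradient_sq {u : Euc n → ℝ} (x : Euc n) :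
    ‖gradient u x‖ ^ 2 = ∑ i, dirDeriv (basisVec i) u x ^ 2 := by
  rw [EuclideanSpace.norm_sq_eq]
  refine Finset.sum_congr rfl fun i _ => ?_
  have : (gradient u x) i = dirDeriv (basisVec i) u x := by
    have h : dirDeriv (basisVec i) u x = inner ℝ (gradient u x) (basisVec i) := by
      rw [gradient, InnerProductSpace.toDual_symm_apply]
      rfl
    rw [h, EuclideanSpace.inner_single_right]
    simp
  rw [this, Real.norm_eq_abs, sq_abs]

/-- If `u` vanished on a sphere, it would vanish in the ball by the minimum principle for `±u`, and
then everywhere. So for `u ≢ 0` the frequency never divides by zero. -/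
theorem IsHarm.sphereIntegral_sq_pos (hn : 0 < n) {u : Euc n → ℝ} (hu : IsHarm u)
    (h0 : ∃ x, u x ≠ 0) {r : ℝ} (hr : 0 < r) : 0 < sphereIntegral (fun x => u x ^ 2) 0 r := by
  unfold sphereIntegral
  refine mul_pos (pow_pos hr _) ?_
  have hc : Continuous fun θ : Metric.sphere (0 : Euc n) 1 => u (0 + r • (θ : Euc n)) ^ 2 :=
    (hu.contDiff.continuous.comp (by fun_prop)).pow 2
  have hnn : ∀ θ : Metric.sphere (0 : Euc n) 1, 0 ≤ u (0 + r • (θ : Euc n)) ^ 2 :=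
    fun θ => sq_nonneg _
  refine lt_of_le_of_ne (integral_nonneg hnn) fun hzero => ?_
  have hint := hc.integrable_of_hasCompactSupport (HasCompactSupport.of_compactSpace _)
    (μ := (volume : Measure (Euc n)).toSphere)
  have hae := (hc.ae_eq_iff_eq _ continuous_zero).1
    ((integral_eq_zero_iff_of_nonneg hnn hint).1 hzero.symm)
  have hsph : ∀ x, ‖x‖ = r → u x = 0 := fun x hx => by
    have h1 : ‖r⁻¹ • x‖ = 1 := by
      rw [norm_smul, norm_inv, Real.norm_of_nonneg hr.le, hx, inv_mul_cancel₀ hr.ne']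
    have h2 := congrFun hae ⟨r⁻¹ • x, by simpa using h1⟩
    simpa [smul_smul, hr.ne'] using h2
  have hball : ∀ x, ‖x‖ ≤ r → u x = 0 := fun x hx => by
    have h1 := hu.nonneg_of_sphere hn hr (fun y hy => (hsph y hy).ge) hx
    have h2 := hu.neg.nonneg_of_sphere hn hr (fun y hy => by simp [hsph y hy]) hx
    linarith
  obtain ⟨x, hx⟩ := h0
  refine hx (hu.eq_zero_of_eventually ?_ x)
  filter_upwards [Metric.ball_mem_nhds (0 : Euc n) hr] with y hy
  exact hball y (by simpa using (mem_ball_zero_iff.1 hy).le)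

/-- A bound on the frequency bounds the logarithmic derivative of the weighted mean squares. -/
theorem IsHarm.hasDerivAt_integral_sq (hn : 0 < n) {u : Euc n → ℝ} (hu : IsHarm u)
    (h0 : ∃ x, u x ≠ 0) {N : ℝ} (hN : ∀ r : ℝ, 0 < r → frequency u 0 r ≤ N) {r : ℝ}
    (hr : 0 < r) : ∃ H' : ℝ,
      HasDerivAt (fun r : ℝ => ∫ x, bump (‖x‖ ^ 2) * u (r • x) ^ 2) H' r ∧
      r * H' ≤ 2 * N * ∫ x, bump (‖x‖ ^ 2) * u (r • x) ^ 2 := by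
  have hd := isProfile_bump.hasDerivAt_dilation (F := fun x => u x ^ 2) (hu.contDiff.pow 2) 0 r
  simp only [zero_add] at hd
  refine ⟨_, hd, ?_⟩
  simp only [lap_sq hu, ← norm_gradient_sq]
  have hgc : Continuous fun x => ‖gradient u x‖ ^ 2 := by
    simp only [norm_gradient_sq]
    exact continuous_finsetSum _ fun i _ =>
      ((hu.isHarm_dirDeriv (basisVec i)).contDiff.continuous).pow 2
  have hG : Continuous fun x : Euc n => ‖gradient u (r • x)‖ ^ 2 := hgc.comp (by fun_prop)
  have hW : Continuous fun x : Euc n => u (r • x) ^ 2 :=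
    (hu.contDiff.continuous.comp (by fun_prop)).pow 2
  -- The frequency bound is used at radius `r * s`; the gradient is evaluated at `r • x` but not
  -- rescaled, hence `N / r ^ 2`.
  have key := integral_primitive_mul_le hn hG hW (N := N / r ^ 2) fun s hs => by
    have hrs : 0 < r * s := mul_pos hr hs.1
    have h1 := hN (r * s) hrs
    have hpos := hu.sphereIntegral_sq_pos hn h0 hrs
    rw [frequency, div_le_iff₀ hpos] at h1
    have h2 := Measure.setIntegral_comp_smul_of_pos (volume : Measure (Euc n))
      (fun x => ‖gradient u x‖ ^ 2) (Metric.ball 0 s) hr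
    rw [smul_ball hr.ne', smul_zero, Real.norm_of_nonneg hr.le, smul_eq_mul,
      finrank_euclideanSpace_fin] at h2
    rw [h2]
    have h3 : sphereIntegral (fun x => u x ^ 2) 0 (r * s) = r ^ (n - 1) * (s ^ (n - 1) *
        ∫ θ : Metric.sphere (0 : Euc n) 1, u (r • s • (θ : Euc n)) ^ 2
          ∂(volume : Measure (Euc n)).toSphere) := by
      simp only [sphereIntegral, zero_add, mul_smul, mul_pow]
      ring
    rw [h3] at h1
    have h4 : r ^ n = r ^ (n - 1) * r := by
      rw [← pow_succ, Nat.sub_add_cancel hn]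
    have h5 : 0 < r ^ (n - 1) := pow_pos hr _
    set X := ∫ x in Metric.ball (0 : Euc n) (r * s), ‖gradient u x‖ ^ 2
    set Y := s ^ (n - 1) * ∫ θ : Metric.sphere (0 : Euc n) 1, u (r • s • (θ : Euc n)) ^ 2
          ∂(volume : Measure (Euc n)).toSphere
    have h6 : s * ((r ^ n)⁻¹ * X) = (r * s * X) / (r ^ (n - 1) * r ^ 2) := by
      rw [h4]
      field_simp
    have h7 : N / r ^ 2 * Y = (N * (r ^ (n - 1) * Y)) / (r ^ (n - 1) * r ^ 2) := by
      field_simp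
    rw [h6, h7]
    gcongr
  have h8 : ∫ x : Euc n, profilePrimitive bump (‖x‖ ^ 2) * (2 * ‖gradient u (r • x)‖ ^ 2) =
      2 * ∫ x : Euc n, profilePrimitive bump (‖x‖ ^ 2) * ‖gradient u (r • x)‖ ^ 2 := by
    rw [← integral_const_mul]
    exact integral_congr_ae (Eventually.of_forall fun x => by ring)
  rw [h8]
  have h9 := mul_le_mul_of_nonneg_left key (sq_nonneg r)
  have h10 : ∀ t : ℝ, r ^ 2 * (2 * (N / r ^ 2) * t) = 2 * N * t := fun t => by field_simp
  rw [h10] at h9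
  linarith

/-- An entire harmonic function with bounded frequency is a polynomial. -/
theorem IsHarm.exists_polynomial_of_frequency {u : Euc n → ℝ} (hu : IsHarm u) {N₀ : ℝ}
    (hN : ∀ r : ℝ, 0 < r → frequency u 0 r < N₀) :
    ∃ U : MvPolynomial (Fin n) ℝ, ∀ x, u x = ev U x := by
  rcases Nat.eq_zero_or_pos n with rfl | hn
  · exact ⟨MvPolynomial.C (u 0), fun x => by rw [ev_C, Subsingleton.elim x 0]⟩
  by_cases h0 : ∃ x, u x ≠ 0
  swap
  · push Not at h0
    exact ⟨0, fun x => by simp [h0 x]⟩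
  obtain ⟨N, hNN⟩ := exists_nat_ge N₀
  set H : ℝ → ℝ := fun r => ∫ x, bump (‖x‖ ^ 2) * u (r • x) ^ 2 with hH
  have hH' : ∀ r : ℝ, 0 < r → ∃ H' : ℝ, HasDerivAt H H' r ∧ r * H' ≤ 2 * N * H r := fun r hr =>
    hu.hasDerivAt_integral_sq hn h0 (fun r hr => (hN r hr).le.trans hNN) hr
  -- `r H' ≤ 2 N H` says exactly that `H / r^(2N)` is nonincreasing; `N₀` was rounded up to a
  -- natural number to make this a polynomial rate.
  have hanti : AntitoneOn (fun r => H r / r ^ (2 * N)) (Ici 1) := by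
    have hder : ∀ r : ℝ, 0 < r → ∃ q : ℝ, HasDerivAt (fun r => H r / r ^ (2 * N)) q r ∧ q ≤ 0 := by
      intro r hr
      obtain ⟨H', h1, h2⟩ := hH' r hr
      refine ⟨_, h1.div (hasDerivAt_pow (2 * N) r) (pow_pos hr _).ne', ?_⟩
      refine div_nonpos_of_nonpos_of_nonneg ?_ (by positivity)
      rcases Nat.eq_zero_or_pos N with rfl | hNpos
      · have : H' ≤ 0 := by
          simp only [Nat.cast_zero, mul_zero, zero_mul] at h2
          exact nonpos_of_mul_nonpos_right h2 hr
        simpa using this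
      · have h3 : r ^ (2 * N) = r ^ (2 * N - 1) * r := by
          rw [← pow_succ, Nat.sub_add_cancel (by omega)]
        have h4 := mul_le_mul_of_nonneg_left h2 (pow_pos hr (2 * N - 1)).le
        push_cast
        rw [h3]
        linarith
    refine antitoneOn_of_deriv_nonpos (convex_Ici 1) (fun r hr => ?_) (fun r hr => ?_)
      fun r hr => ?_
    · obtain ⟨q, hq, -⟩ := hder r (zero_lt_one.trans_le hr)
      exact hq.continuousAt.continuousWithinAt
    · rw [interior_Ici] at hr
      obtain ⟨q, hq, -⟩ := hder r (zero_lt_one.trans hr)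
      exact hq.differentiableAt.differentiableWithinAt
    · rw [interior_Ici] at hr
      obtain ⟨q, hq, hq0⟩ := hder r (zero_lt_one.trans hr)
      rw [hq.deriv]
      exact hq0
  set I := ∫ x : Euc n, bump (‖x‖ ^ 2) with hI
  have hI0 : 0 < I := integral_bump_pos
  have hH1 : 0 ≤ H 1 := integral_nonneg fun x => mul_nonneg (bump_nonneg _) (sq_nonneg _)
  have hgrowth : ∀ᶠ r : ℝ in atTop,
      ∫ x, bump (‖x‖ ^ 2) * |ev (1 : MvPolynomial (Fin n) ℝ) (r • x) * u (r • x)| ≤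
        (I + H 1) * (r ^ (2 * N) * √r) := by
    filter_upwards [eventually_ge_atTop 1] with r hr
    have hr0 : 0 < r := by linarith
    have hcu : Continuous fun x : Euc n => u (r • x) :=
      hu.contDiff.continuous.comp (by fun_prop)
    have h1 := hanti (mem_Ici.2 (le_refl (1 : ℝ))) (mem_Ici.2 hr) hr
    simp only [one_pow, div_one] at h1
    rw [div_le_iff₀ (pow_pos hr0 _)] at h1
    have h2 : ∫ x, bump (‖x‖ ^ 2) * |ev (1 : MvPolynomial (Fin n) ℝ) (r • x) * u (r • x)| ≤
        ∫ x : Euc n, (bump (‖x‖ ^ 2) * 1 + bump (‖x‖ ^ 2) * u (r • x) ^ 2) := by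
      simp only [ev_one, one_mul]
      refine integral_mono (integrable_bump_mul hcu.abs) ((integrable_bump_mul
        continuous_const).add (integrable_bump_mul (hcu.pow 2))) fun x => ?_
      simp only
      rw [← mul_add]
      refine mul_le_mul_of_nonneg_left ?_ (bump_nonneg _)
      nlinarith [sq_nonneg (|u (r • x)| - 1), sq_abs (u (r • x)), abs_nonneg (u (r • x))]
    have hsq : Continuous fun x : Euc n => u (r • x) ^ 2 := hcu.pow 2
    rw [integral_add (integrable_bump_mul continuous_const) (integrable_bump_mul hsq)] at h2
    simp only [mul_one] at h2
    change _ ≤ I + H r at h2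
    have h3 : 1 ≤ r ^ (2 * N) := one_le_pow₀ hr
    have h4 : 1 ≤ √r := Real.one_le_sqrt.2 hr
    have h5 : I + H r ≤ (I + H 1) * r ^ (2 * N) := by nlinarith
    have h6 : (I + H 1) * r ^ (2 * N) ≤ (I + H 1) * (r ^ (2 * N) * √r) :=
      mul_le_mul_of_nonneg_left (le_mul_of_one_le_right (by positivity) h4) (by positivity)
    linarith
  -- The growth theorem with multiplier `U = 1`; the mean of `|u|` was controlled through `|u| ≤ 1 +
  -- u²`.
  obtain ⟨V, hV, -⟩ := hu.exists_polynomial_of_growth one_ne_zero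
    (by rw [MvPolynomial.totalDegree_one]; exact Nat.zero_le _) hgrowth.frequently
  exact ⟨V, hV⟩

/-! ### The growth condition and the conclusion. -/

/-- The growth condition bounds the quotient on a sequence of balls. -/
theorem RatioGrowth.exists_frequently_le {u v : Euc n → ℝ} (h : RatioGrowth (1 / 2) u v) :
    ∃ C : ℝ, 0 ≤ C ∧
      ∃ᶠ r : ℝ in atTop, ∀ x, ‖x‖ < r → u x ≠ 0 → v x / u x ≤ C * √r := by
  obtain ⟨b, hb, -⟩ := EReal.lt_iff_exists_real_btwn.1 h
  refine ⟨max b 0, le_max_right _ _, ?_⟩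
  refine ((frequently_lt_of_liminf_lt (by isBoundedDefault) hb).and_eventually
    (eventually_gt_atTop 0)).mono ?_
  rintro r ⟨hlt, hr⟩ x hx hux
  have h1 : ((v x / u x : ℝ) : EReal) ≤ supRatio u v r :=
    le_iSup₂ (f := fun x (_ : x ∈ Metric.ball (0 : Euc n) r \ zeroSet u) =>
      ((v x / u x : ℝ) : EReal)) x ⟨mem_ball_zero_iff.2 hx, hux⟩
  have h2 : ((r ^ (-(1 / 2) : ℝ) * (v x / u x) : ℝ) : EReal) ≤ b := by
    rw [EReal.coe_mul]
    exact (mul_le_mul_of_nonneg_left h1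
      (EReal.coe_nonneg.2 (Real.rpow_nonneg hr.le _))).trans hlt.le
  have h3 := EReal.coe_le_coe_iff.1 h2
  rw [Real.rpow_neg hr.le, ← Real.sqrt_eq_rpow, inv_mul_le_iff₀ (Real.sqrt_pos.2 hr)] at h3
  calc v x / u x ≤ √r * b := h3
    _ ≤ √r * max b 0 := mul_le_mul_of_nonneg_left (le_max_left _ _) (Real.sqrt_nonneg _)
    _ = _ := mul_comm _ _

/-- The ratio is `c` wherever it is defined, and `r^(-β) ≤ 1` for `r ≥ 1`. If `u ≡ 0` the supremum
is over the empty set, equals `⊥`, and the bound by `|c|` persists. -/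
theorem ratioGrowth_of_eq_const_mul {u v : Euc n → ℝ} {c β : ℝ} (hβ : 0 ≤ β)
    (h : ∀ x, v x = c * u x) : RatioGrowth β u v := by
  refine lt_of_le_of_lt ?_ (EReal.coe_lt_top |c|)
  refine liminf_le_of_frequently_le' (Eventually.frequently ?_)
  filter_upwards [eventually_ge_atTop 1] with r hr
  have hr0 : 0 ≤ r ^ (-β) := Real.rpow_nonneg (by linarith) _
  have h1 : supRatio u v r ≤ ((|c| : ℝ) : EReal) := iSup₂_le fun x hx => by
    have hux : u x ≠ 0 := hx.2
    rw [h x, mul_div_cancel_right₀ _ hux]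
    exact EReal.coe_le_coe_iff.2 (le_abs_self c)
  refine (mul_le_mul_of_nonneg_left h1 (EReal.coe_nonneg.2 hr0)).trans ?_
  rw [← EReal.coe_mul]
  exact EReal.coe_le_coe_iff.2 (mul_le_of_le_one_left (abs_nonneg c)
    (Real.rpow_le_one_of_one_le_of_nonpos hr (neg_nonpos.2 hβ)))

/-- A function with the nodal set of a harmonic polynomial is a nonzero multiple of it. -/
theorem IsHarm.exists_ne_zero_of_zeroSet_eq {u v : Euc n → ℝ} (hu : IsHarm u) (hv : IsHarm v)
    {U : MvPolynomial (Fin n) ℝ} (hU : ∀ x, u x = ev U x) (hZ : zeroSet u = zeroSet v) :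
    ∃ c : ℝ, c ≠ 0 ∧ ∀ x, v x = c * u x := by
  obtain rfl : u = ev U := funext hU
  have hZ' : ∀ x, ev U x = 0 ↔ v x = 0 := fun x => Set.ext_iff.1 hZ x
  -- For `U = 0` both functions vanish identically and any nonzero constant serves.
  rcases eq_or_ne U 0 with rfl | h0
  · exact ⟨1, one_ne_zero, fun x => by rw [(hZ' x).1 (by simp)]; simp⟩
  · exact hu.exists_ne_zero_eq_const_mul h0 hv hZ'

theorem IsHarm.exists_of_zeroSet_subset {u v : Euc n → ℝ} (hu : IsHarm u) (hv : IsHarm v)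
    {U : MvPolynomial (Fin n) ℝ} (hU : ∀ x, u x = ev U x) (hZ : zeroSet u ⊆ zeroSet v)
    (hg : RatioGrowth (1 / 2) u v) : ∃ c : ℝ, ∀ x, v x = c * u x := by
  obtain rfl : u = ev U := funext hU
  have hZ' : ∀ x, ev U x = 0 → v x = 0 := fun x hx => hZ hx
  rcases eq_or_ne U 0 with rfl | h0
  · exact ⟨0, fun x => by rw [hZ' x (by simp)]; simp⟩
  · obtain ⟨C, hC, h⟩ := hg.exists_frequently_le
    exact hu.exists_eq_const_mul h0 hv hZ' hC h

end NodalRatio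

end

theorem theorem1p3 (n : ℕ) :
    (∀ u v : EuclideanSpace ℝ (Fin n) → ℝ,
      NodalRatio.IsEntireHarmonic u → NodalRatio.IsEntireHarmonic v →
      NodalRatio.IsPolynomialFunction u →
      NodalRatio.zeroSet u = NodalRatio.zeroSet v →
      ∃ c : ℝ, c ≠ 0 ∧ ∀ x, v x = c * u x) ∧
    (∀ N₀ : ℝ, ∃ β : ℝ, 0 < β ∧ β < 1 ∧
      ∀ u v : EuclideanSpace ℝ (Fin n) → ℝ,
        NodalRatio.IsEntireHarmonic u → NodalRatio.IsEntireHarmonic v →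
        (∀ r : ℝ, 0 < r → NodalRatio.frequency u 0 r < N₀) →
        (NodalRatio.zeroSet u ⊆ NodalRatio.zeroSet v → NodalRatio.RatioGrowth β u v →
          ∃ c : ℝ, ∀ x, v x = c * u x) ∧
        (NodalRatio.zeroSet u = NodalRatio.zeroSet v →
          NodalRatio.RatioGrowth β u v ∧ ∃ c : ℝ, c ≠ 0 ∧ ∀ x, v x = c * u x)) := by
  -- The exponent `1 / 2` depends on neither `n` nor `N₀`; the frequency bound enters only to make
  -- `u` a polynomial.
  refine ⟨fun u v hu hv ⟨U, hU⟩ hZ => hu.isHarm.exists_ne_zero_of_zeroSet_eq hv.isHarm hU hZ,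
    fun N₀ => ⟨1 / 2, by norm_num, by norm_num, fun u v hu hv hN => ?_⟩⟩
  obtain ⟨U, hU⟩ := hu.isHarm.exists_polynomial_of_frequency hN
  refine ⟨fun hZ hg => hu.isHarm.exists_of_zeroSet_subset hv.isHarm hU hZ hg, fun hZ => ?_⟩
  obtain ⟨c, hc, h⟩ := hu.isHarm.exists_ne_zero_of_zeroSet_eq hv.isHarm hU hZ
  exact ⟨NodalRatio.ratioGrowth_of_eq_const_mul (by norm_num) h, c, hc, h⟩
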